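/- **Setting.** A tracial $\mathrm{W}^*$-algebra $(\mathcal M,\tau)$ is a von Neumann algebra with a faithful normal tracial state; $\|a\|_2=\tau(a^*a)^{1/2}$, and $L^2(\mathcal M)$ is the completion for $\|\cdot\|_2$. For a $\mathrm{W}^*$-subalgebra $\mathcal P\subseteq\mathcal M$, $E_{\mathcal P}$ is the trace-preserving conditional expectation of $\mathcal M$ onto $\mathcal P$. On $M_n(\mathbb C)$ the trace is $\tau_n=\frac1n\mathrm{Tr}$. For an index set $I$, $\mathbb C\langle t_i:i\in I\rangle$ is the $*$-algebra of non-commutative polynomials in self-adjoint variables $t_i$. *Function spaces.* For $\mathbf R\in(0,\infty)^I$ let $\Sigma_{\mathbf R}$ be the set of unital positive tracial linear functionals $\lambda$ on $\mathbb C\langle t_i:i\in I\rangle$ with $|\lambda(t_{i(1)}\cdots t_{i(\ell)})|\le R_{i(1)}\cdots R_{i(\ell)}$ for all $\ell$ and $i(1),\dots,i(\ell)$, with the topology of pointwise convergence. For a self-adjoint tuple $\mathbf x\in\mathcal M_{sa}^I$ with $\|x_i\|\le R_i$, let $\lambda_{\mathbf x}(p)=\tau(p(\mathbf x))$, and for $\phi\otimes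 p\in\mathcal A_{\mathbf R}=C(\Sigma_{\mathbf R})\otimes\mathbb C\langle t_i:i\in I\rangle$ let $(\phi\otimes p)(\mathbf x)=\phi(\lambda_{\mathbf x})p(\mathbf x)$, extended linearly. $\mathcal F_{\mathbf R,2}$ is the separated completion of $\mathcal A_{\mathbf R}$ for the seminorm $\|f\|_{\mathbf R,2}=\sup\|f(\mathbf x)\|_2$, the supremum being over all $(\mathcal M,\tau)$ and all $\mathbf x\in\mathcal M_{sa}^I$ with $\|x_i\|\le R_i$; evaluation extends to $f\mapsto f(\mathbf x)\in L^2(\mathcal M)$. For $\mathbf R'\in(0,\infty)^{I'}$, $\mathcal F_{\mathbf R,\mathbf R'}$ is the set of tuples $\mathbf f=(f_i)_{i\in I'}$ in $\mathcal F_{\mathbf R,2}$ such that for every $i\in I'$, every $(\mathcal M,\tau)$ and every such $\mathbf x$, $f_i(\mathbf x)$ is a self-adjoint element of $\mathcal M$ with $\|f_i(\mathbf x)\|\le R_i'$. Put $\mathbf f(\mathbf x)=(f_i(\mathbf x))_{i\in I'}$. *Random matrix models.* Let $n(k)\ge1$ be integers with $n(k)\to\infty$. Borel probability measures $\mu^{(k)}$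 on $M_{n(k)}(\mathbb C)_{sa}^I$ (product topology), $k\in\mathbb N$, are said to satisfy (1)–(4) with respect to $\mathcal P\subseteq\mathcal M$, a tuple $\mathbf x\in\mathcal M_{sa}^I$ of generators of $\mathcal M$, and $\mathbf R$, if 1. $\mu^{(k)}$ is supported on $\{\mathbf A:\|A_i\|\le R_i\text{ for all }i\}$, for every $k$; 2. for every $p\in\mathbb C\langle t_i:i\in I\rangle$ and $\varepsilon>0$, $\mu^{(k)}\{\mathbf A:|\tau_{n(k)}(p(\mathbf A))-\tau(p(\mathbf x))|\ge\varepsilon\}\to0$; 3. for every finite $F\subseteq I$ and $\varepsilon>0$, $\limsup_{k\to\infty}\frac1{n(k)^2}\log\alpha_{\mu^{(k)}}(F,\varepsilon)<0$, where $\alpha_\mu(F,\varepsilon)=\sup\{\mu(N_{F,\varepsilon}(\Omega)^c):\Omega\text{ Borel},\ \mu(\Omega)\ge\frac12\}$ and $N_{F,\varepsilon}(\Omega)=\{\mathbf B:\exists\mathbf A\in\Omega\ \forall i\in F\ \|A_i-B_i\|_2<\varepsilon\}$; 4. for every $p\in\mathbb C\langle t_i:i\in I\rangle$, $\bigl\|\int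 p(\mathbf A)\,d\mu^{(k)}(\mathbf A)\bigr\|_2\to\|E_{\mathcal P}[p(\mathbf x)]\|_2$. If $\mu$ is a probability measure on $M_n(\mathbb C)_{sa}^I$ supported on $\{\mathbf A:\|A_i\|\le R_i\}$ and $\mathbf f\in\mathcal F_{\mathbf R,\mathbf R'}$, then $\mathbf f_*\mu$ denotes the push-forward of $\mu$ under $\mathbf A\mapsto\mathbf f(\mathbf A)$. **Proposition.** Let $(\mathcal M,\tau)$ be a tracial $\mathrm{W}^*$-algebra, $\mathcal P\subseteq\mathcal M$ a $\mathrm{W}^*$-subalgebra, and $\mathbf x\in\mathcal M_{sa}^I$ a tuple generating $\mathcal M$ as a $\mathrm{W}^*$-algebra, where $I$ is an arbitrary index set. Let $\mathbf R\in(0,\infty)^I$ with $\|x_i\|\le R_i$, let $\mathbf R'\in(0,\infty)^{I'}$, and let $n(k)\to\infty$. (a) Let $\mathbf f\in\mathcal F_{\mathbf R,\mathbf R'}$, let $\mathbf y=\mathbf f(\mathbf x)$ and $\mathcal Q=\mathrm W^*(\mathbf y)$, and suppose that $E_{\mathcal P}\circ E_{\mathcal Q}=E_{\mathcal P\cap\mathcal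 Q}$. If $\{\mu^{(k)}\}$ satisfies (1)–(4) with respect to $\mathcal P\subseteq\mathcal M$, $\mathbf x$ and $\mathbf R$, then $\{\mathbf f_*\mu^{(k)}\}$ is a sequence of Borel probability measures satisfying (1)–(4) with respect to $\mathcal P\cap\mathcal Q\subseteq\mathcal Q$, $\mathbf y$ and $\mathbf R'$. (b) In particular, the existence of such models does not depend on the choice of generators: if $\mathbf y\in\mathcal M_{sa}^{I'}$ also generates $\mathcal M$ and $\|y_i\|\le R_i'$ for all $i$, then there are measures satisfying (1)–(4) with respect to $\mathcal P\subseteq\mathcal M$, $\mathbf x$ and $\mathbf R$ if and only if there are measures (for the same $n(k)$) satisfying (1)–(4) with respect to $\mathcal P\subseteq\mathcal M$, $\mathbf y$ and $\mathbf R'$. -/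

import Mathlib

open scoped TensorProduct Topology InnerProductSpace ComplexOrder ENNReal
open Filter MeasureTheory

universe u

noncomputable section

/-! ### Von Neumann subalgebras: intersections and generation -/

namespace VonNeumannAlgebra

variable {H : Type u} [NormedAddCommGroup H] [InnerProductSpace ℂ H] [CompleteSpace H]

/-- The intersection `P ∩ Q` of two von Neumann algebras on the same Hilbert space. -/
def inter (P Q : VonNeumannAlgebra H) : VonNeumannAlgebra H where
  toStarSubalgebra := P.toStarSubalgebra ⊓ Q.toStarSubalgebra
  centralizer_centralizer' := by
    apply subset_antisymm
    · intro a ha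
      refine ⟨?_, ?_⟩
      · have h : a ∈ Set.centralizer (Set.centralizer (P : Set (H →L[ℂ] H))) :=
          Set.centralizer_subset (Set.centralizer_subset (fun b hb => hb.1)) ha
        rw [P.centralizer_centralizer] at h
        exact h
      · have h : a ∈ Set.centralizer (Set.centralizer (Q : Set (H →L[ℂ] H))) :=
          Set.centralizer_subset (Set.centralizer_subset (fun b hb => hb.2)) ha
        rw [Q.centralizer_centralizer] at h
        exact h
    · exact Set.subset_centralizer_centralizer

/-- The von Neumann algebra `(S ∪ S^*)''` generated by a set `S` of bounded operators. -/
def generatedBy (S : Set (H →L[ℂ] H)) : VonNeumannAlgebra H where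
  toStarSubalgebra :=
    StarSubalgebra.centralizer ℂ (StarSubalgebra.centralizer ℂ S : Set (H →L[ℂ] H))
  centralizer_centralizer' := by
    change Set.centralizer (Set.centralizer (StarSubalgebra.centralizer ℂ
      (StarSubalgebra.centralizer ℂ S : Set (H →L[ℂ] H)) : Set (H →L[ℂ] H))) =
      (StarSubalgebra.centralizer ℂ
      (StarSubalgebra.centralizer ℂ S : Set (H →L[ℂ] H)) : Set (H →L[ℂ] H))
    rw [StarSubalgebra.coe_centralizer_centralizer]
    simp

lemma subset_generatedBy (S : Set (H →L[ℂ] H)) {a : H →L[ℂ] H} (ha : a ∈ S) :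
    a ∈ generatedBy S := by
  change a ∈ (StarSubalgebra.centralizer ℂ
      (StarSubalgebra.centralizer ℂ S : Set (H →L[ℂ] H)) : Set (H →L[ℂ] H))
  rw [StarSubalgebra.coe_centralizer_centralizer]
  exact Set.subset_centralizer_centralizer (Or.inl ha)

lemma generatedBy_le {S : Set (H →L[ℂ] H)} {P : VonNeumannAlgebra H}
    (h : ∀ a ∈ S, a ∈ P) : generatedBy S ≤ P := by
  intro a ha
  change a ∈ (StarSubalgebra.centralizer ℂ
      (StarSubalgebra.centralizer ℂ S : Set (H →L[ℂ] H)) : Set (H →L[ℂ] H)) at ha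
  rw [StarSubalgebra.coe_centralizer_centralizer] at ha
  have hS : S ∪ star S ⊆ (P : Set (H →L[ℂ] H)) := by
    rintro b (hb | hb)
    · exact h b hb
    · have := star_mem (h _ hb)
      rwa [star_star] at this
  have h' := Set.centralizer_subset (Set.centralizer_subset hS) ha
  rw [P.centralizer_centralizer] at h'
  exact h'

end VonNeumannAlgebra

/-! ### Tracial `W^*`-algebras -/

/-- A tracial `W^*`-algebra `(M, τ)`: a von Neumann algebra `alg` on a complex Hilbert space `H`
together with a faithful normal tracial state `τ`.  Normality (ultraweak continuity) of the positive
functional `τ` is expressed in the density-matrix form `τ(a) = ∑ₘ ⟨ξₘ, a ξₘ⟩` with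
`∑ₘ ‖ξₘ‖² < ∞`. -/
structure TracialWStarAlgebra : Type (u + 1) where
  H : Type u
  [instNormedAddCommGroup : NormedAddCommGroup H]
  [instInnerProductSpace : InnerProductSpace ℂ H]
  [instCompleteSpace : CompleteSpace H]
  alg : VonNeumannAlgebra H
  τ : alg.toStarSubalgebra →ₗ[ℂ] ℂ
  unital : τ 1 = 1
  positive : ∀ a, 0 ≤ τ (star a * a)
  tracial : ∀ a b, τ (a * b) = τ (b * a)
  faithful : ∀ a, τ (star a * a) = 0 → a = 0
  normal : ∃ ξ : ℕ → H, Summable (fun m => ‖ξ m‖ ^ 2) ∧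
    ∀ a : alg.toStarSubalgebra, HasSum (fun m => ⟪ξ m, (a : H →L[ℂ] H) (ξ m)⟫_ℂ) (τ a)

attribute [instance] TracialWStarAlgebra.instNormedAddCommGroup
attribute [instance] TracialWStarAlgebra.instInnerProductSpace
attribute [instance] TracialWStarAlgebra.instCompleteSpace

namespace TracialWStarAlgebra

/-- The elements of `M`; the norm is the operator norm. -/
abbrev Elem (M : TracialWStarAlgebra.{u}) : Type u := M.alg.toStarSubalgebra

/-- The `2`-norm `‖a‖₂ = τ(a^* a)^{1/2}`. -/
def norm2 (M : TracialWStarAlgebra.{u}) (a : M.Elem) : ℝ := Real.sqrt (M.τ (star a * a)).re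

/-- A `W^*`-subalgebra `Q ⊆ M`, with the restricted trace, as a tracial `W^*`-algebra. -/
def sub (M : TracialWStarAlgebra.{u}) (Q : VonNeumannAlgebra M.H) (hQ : Q ≤ M.alg) :
    TracialWStarAlgebra.{u} where
  H := M.H
  alg := Q
  τ := M.τ ∘ₗ (StarSubalgebra.inclusion (S₁ := Q.toStarSubalgebra)
    (S₂ := M.alg.toStarSubalgebra) hQ).toAlgHom.toLinearMap
  unital := M.unital
  positive a := M.positive (StarSubalgebra.inclusion (S₁ := Q.toStarSubalgebra)
    (S₂ := M.alg.toStarSubalgebra) hQ a)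
  tracial a b := M.tracial (StarSubalgebra.inclusion (S₁ := Q.toStarSubalgebra)
    (S₂ := M.alg.toStarSubalgebra) hQ a) (StarSubalgebra.inclusion (S₁ := Q.toStarSubalgebra)
    (S₂ := M.alg.toStarSubalgebra) hQ b)
  faithful a h := by
    have := M.faithful (StarSubalgebra.inclusion (S₁ := Q.toStarSubalgebra)
      (S₂ := M.alg.toStarSubalgebra) hQ a) h
    exact Subtype.ext (congrArg Subtype.val this :)
  normal := by
    obtain ⟨ξ, h1, h2⟩ := M.normal
    exact ⟨ξ, h1, fun a => h2 (StarSubalgebra.inclusion (S₁ := Q.toStarSubalgebra)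
      (S₂ := M.alg.toStarSubalgebra) hQ a)⟩

/-- The `W^*`-subalgebra `W^*(x)` generated by a self-adjoint tuple `x` in `M`. -/
def wStar (M : TracialWStarAlgebra.{u}) {I : Type u} (x : I → selfAdjoint M.Elem) :
    VonNeumannAlgebra M.H :=
  VonNeumannAlgebra.generatedBy (Set.range fun i => ((x i : M.Elem) : M.H →L[ℂ] M.H))

lemma wStar_le (M : TracialWStarAlgebra.{u}) {I : Type u} (x : I → selfAdjoint M.Elem) :
    M.wStar x ≤ M.alg :=
  VonNeumannAlgebra.generatedBy_le (by rintro _ ⟨i, rfl⟩; exact (x i : M.Elem).2)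

/-- The tracial `W^*`-algebra `(W^*(x), τ)`. -/
def generated (M : TracialWStarAlgebra.{u}) {I : Type u} (x : I → selfAdjoint M.Elem) :
    TracialWStarAlgebra.{u} :=
  M.sub (M.wStar x) (M.wStar_le x)

/-- The tuple `x`, regarded as a tuple in `W^*(x)`. -/
def generators (M : TracialWStarAlgebra.{u}) {I : Type u} (x : I → selfAdjoint M.Elem) (i : I) :
    selfAdjoint (M.generated x).Elem :=
  ⟨⟨((x i : M.Elem) : M.H →L[ℂ] M.H), VonNeumannAlgebra.subset_generatedBy _ ⟨i, rfl⟩⟩,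
    Subtype.ext (congrArg Subtype.val (x i).2 :)⟩

/-! #### The Hilbert space `L²(M)` and conditional expectations -/

/-- `M` equipped with the inner product `⟨a, b⟩ = τ(a^* b)`. -/
def PreL2 (M : TracialWStarAlgebra.{u}) : Type u := M.Elem

instance (M : TracialWStarAlgebra.{u}) : AddCommGroup M.PreL2 :=
  inferInstanceAs (AddCommGroup M.Elem)

instance (M : TracialWStarAlgebra.{u}) : Module ℂ M.PreL2 :=
  inferInstanceAs (Module ℂ M.Elem)

def toPreL2 (M : TracialWStarAlgebra.{u}) : M.Elem ≃ₗ[ℂ] M.PreL2 := LinearEquiv.refl ℂ _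

lemma τ_star (M : TracialWStarAlgebra.{u}) (a : M.Elem) :
    M.τ (star a) = starRingEnd ℂ (M.τ a) := by
  obtain ⟨ξ, -, h⟩ := M.normal
  have h1 := (Complex.hasSum_conj'.mpr (h a))
  refine (h (star a)).unique ?_
  convert h1 using 2 with m
  simp only [StarMemClass.coe_star, ContinuousLinearMap.star_eq_adjoint]
  rw [ContinuousLinearMap.adjoint_inner_right, inner_conj_symm]

abbrev core (M : TracialWStarAlgebra.{u}) : InnerProductSpace.Core ℂ M.PreL2 where
  inner a b := M.τ (star (M.toPreL2.symm a) * M.toPreL2.symm b)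
  conj_inner_symm a b := by
    rw [← M.τ_star]; simp
  re_inner_nonneg a := (RCLike.nonneg_iff.mp (M.positive (M.toPreL2.symm a))).1
  add_left a b c := by simp [add_mul]
  smul_left a b r := by simp
  definite a h := by
    have := M.faithful _ h
    simpa using this

instance (M : TracialWStarAlgebra.{u}) : NormedAddCommGroup M.PreL2 :=
  InnerProductSpace.Core.toNormedAddCommGroup (cd := M.core)

instance (M : TracialWStarAlgebra.{u}) : InnerProductSpace ℂ M.PreL2 :=
  InnerProductSpace.ofCore M.core.toCore

/-- The Hilbert space `L²(M)`: the completion of `M` for the `2`-norm. -/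
abbrev L2 (M : TracialWStarAlgebra.{u}) : Type u := UniformSpace.Completion M.PreL2

/-- The canonical map `M → L²(M)`. -/
def toL2 (M : TracialWStarAlgebra.{u}) : M.Elem →ₗ[ℂ] M.L2 :=
  (UniformSpace.Completion.toComplₗᵢ (𝕜 := ℂ) (E := M.PreL2)).toLinearMap ∘ₗ M.toPreL2.toLinearMap

lemma inner_toL2 (M : TracialWStarAlgebra.{u}) (a b : M.Elem) :
    ⟪M.toL2 a, M.toL2 b⟫_ℂ = M.τ (star a * b) := by
  change ⟪((M.toPreL2 a : M.PreL2) : M.L2), ((M.toPreL2 b : M.PreL2) : M.L2)⟫_ℂ = _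
  rw [UniformSpace.Completion.inner_coe]
  rfl

lemma norm_toL2 (M : TracialWStarAlgebra.{u}) (a : M.Elem) : ‖M.toL2 a‖ = M.norm2 a := by
  rw [norm_eq_sqrt_re_inner (𝕜 := ℂ), inner_toL2]; rfl

lemma toL2_injective (M : TracialWStarAlgebra.{u}) : Function.Injective M.toL2 := by
  intro a b h
  exact M.toPreL2.injective (UniformSpace.Completion.coe_injective _ h)

/-- The subspace `L²(P) ⊆ L²(M)`: the closure of `P`. -/
def L2Sub (M : TracialWStarAlgebra.{u}) (P : VonNeumannAlgebra M.H) : Submodule ℂ M.L2 :=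
  (Submodule.map M.toL2 (Submodule.comap M.alg.toStarSubalgebra.toSubalgebra.toSubmodule.subtype
    P.toStarSubalgebra.toSubalgebra.toSubmodule)).topologicalClosure

/-- The trace-preserving conditional expectation `E_P` of `M` onto a `W^*`-subalgebra `P`, extended
to `L²(M)`, i.e. the orthogonal projection of `L²(M)` onto `L²(P)`.  On `M` it agrees with the
trace-preserving conditional expectation `M → P`, see `condExp_toL2_eq`. -/
def condExp (M : TracialWStarAlgebra.{u}) (P : VonNeumannAlgebra M.H) : M.L2 →L[ℂ] M.L2 :=
  haveI : CompleteSpace (M.L2Sub P) :=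
    (Submodule.isClosed_topologicalClosure _).completeSpace_coe
  (M.L2Sub P).starProjection

/-- The characteristic property of `E_P(a)`: if `b ∈ P` and `τ(c b) = τ(c a)` for all `c ∈ P`, then
`b = E_P(a)`. -/
lemma condExp_toL2_eq (M : TracialWStarAlgebra.{u}) (P : VonNeumannAlgebra M.H) (a b : M.Elem)
    (hb : (b : M.H →L[ℂ] M.H) ∈ P)
    (h : ∀ c : M.Elem, (c : M.H →L[ℂ] M.H) ∈ P → M.τ (c * b) = M.τ (c * a)) :
    M.condExp P (M.toL2 a) = M.toL2 b := by
  have : CompleteSpace (M.L2Sub P) :=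
    (Submodule.isClosed_topologicalClosure _).completeSpace_coe
  have hmem : M.toL2 b ∈ M.L2Sub P := Submodule.le_topologicalClosure _ ⟨b, hb, rfl⟩
  refine Submodule.eq_starProjection_of_mem_of_inner_eq_zero (K := M.L2Sub P) hmem ?_
  intro w hw
  have hcl : IsClosed {w : M.L2 | ⟪M.toL2 a - M.toL2 b, w⟫_ℂ = 0} :=
    isClosed_eq (by fun_prop) continuous_const
  refine closure_minimal ?_ hcl hw
  rintro _ ⟨c, hc, rfl⟩
  have hc' : ((star c : M.Elem) : M.H →L[ℂ] M.H) ∈ P := star_mem (S := VonNeumannAlgebra M.H) hc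
  have := h (star c) hc'
  rw [Set.mem_ofPred_eq, ← inner_conj_symm, inner_sub_right, inner_toL2, inner_toL2, this]
  simp

end TracialWStarAlgebra

/-! ### Matrix algebras -/

/-- The orthonormal basis vectors of `ℂⁿ`. -/
abbrev matrixBasis (n : ℕ) : OrthonormalBasis (ULift.{u} (Fin n)) ℂ
    (EuclideanSpace ℂ (ULift.{u} (Fin n))) :=
  EuclideanSpace.basisFun _ ℂ

/-- All operators on `H`, as a von Neumann algebra. -/
def allOperators (H : Type u) [NormedAddCommGroup H] [InnerProductSpace ℂ H] [CompleteSpace H] :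
    VonNeumannAlgebra H where
  toStarSubalgebra := ⊤
  centralizer_centralizer' := by
    apply subset_antisymm
    · intro a _; trivial
    · exact Set.subset_centralizer_centralizer

/-- The space `ℂⁿ`. -/
abbrev CSpace (n : ℕ) : Type u := EuclideanSpace ℂ (ULift.{u} (Fin n))

/-- The trace `Tr` of operators on `ℂⁿ`. -/
def opTrace (n : ℕ) : (CSpace.{u} n →L[ℂ] CSpace.{u} n) →ₗ[ℂ] ℂ :=
  LinearMap.trace ℂ (CSpace.{u} n) ∘ₗ ContinuousLinearMap.coeLM ℂ

lemma opTrace_eq_sum (n : ℕ) (a : CSpace.{u} n →L[ℂ] CSpace.{u} n) :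
    opTrace n a = ∑ i, ⟪matrixBasis.{u} n i, a (matrixBasis.{u} n i)⟫_ℂ :=
  LinearMap.trace_eq_sum_inner _ (matrixBasis.{u} n)

lemma opTrace_star_mul_self (n : ℕ) (a : CSpace.{u} n →L[ℂ] CSpace.{u} n) :
    opTrace n (star a * a) = ((∑ i, ‖a (matrixBasis.{u} n i)‖ ^ 2 : ℝ) : ℂ) := by
  rw [opTrace_eq_sum]
  push_cast
  refine Finset.sum_congr rfl fun i _ => ?_
  change ⟪matrixBasis.{u} n i, star a (a (matrixBasis.{u} n i))⟫_ℂ = _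
  rw [ContinuousLinearMap.star_eq_adjoint,
    ContinuousLinearMap.adjoint_inner_right, inner_self_eq_norm_sq_to_K]
  rfl

/-- The tracial `W^*`-algebra `(M_n(ℂ), τ_n)`: all operators on `ℂⁿ` with the normalized trace
`τ_n = (1/n) Tr`. -/
def matrixAlgebra (n : ℕ) [NeZero n] : TracialWStarAlgebra.{u} where
  H := CSpace.{u} n
  alg := allOperators _
  τ := (n : ℂ)⁻¹ • (opTrace.{u} n ∘ₗ
    (allOperators (CSpace.{u} n)).toStarSubalgebra.subtype.toAlgHom.toLinearMap)
  unital := by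
    change (n : ℂ)⁻¹ • LinearMap.trace ℂ (CSpace.{u} n) 1 = 1
    rw [LinearMap.trace_one]
    simp
  positive a := by
    change 0 ≤ (n : ℂ)⁻¹ • opTrace n (star a.1 * a.1)
    rw [opTrace_star_mul_self, smul_eq_mul]
    refine mul_nonneg (by positivity) ?_
    exact_mod_cast Finset.sum_nonneg fun i _ => by positivity
  tracial a b := by
    change (n : ℂ)⁻¹ • LinearMap.trace ℂ (CSpace.{u} n) ((a.1 : CSpace.{u} n →ₗ[ℂ] CSpace.{u} n) * (b.1 : CSpace.{u} n →ₗ[ℂ] CSpace.{u} n)) =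
      (n : ℂ)⁻¹ • LinearMap.trace ℂ (CSpace.{u} n) ((b.1 : CSpace.{u} n →ₗ[ℂ] CSpace.{u} n) * (a.1 : CSpace.{u} n →ₗ[ℂ] CSpace.{u} n))
    rw [LinearMap.trace_mul_comm]
  faithful a h := by
    change (n : ℂ)⁻¹ • opTrace n (star a.1 * a.1) = 0 at h
    rw [opTrace_star_mul_self, smul_eq_mul, mul_eq_zero] at h
    have h' := h.resolve_left (by simp [NeZero.ne n])
    rw [Complex.ofReal_eq_zero, Finset.sum_eq_zero_iff_of_nonneg (fun i _ => by positivity)] at h'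
    apply Subtype.ext
    apply ContinuousLinearMap.coe_injective
    refine (matrixBasis.{u} n).toBasis.ext fun i => ?_
    simpa using h' i (Finset.mem_univ i)
  normal := by
    let c : ℂ := ((Real.sqrt n)⁻¹ : ℝ)
    have hc : starRingEnd ℂ c * c = (n : ℂ)⁻¹ := by
      simp only [c, Complex.conj_ofReal]
      rw [← Complex.ofReal_mul, ← mul_inv, Real.mul_self_sqrt (by positivity)]
      simp
    let ξ : ℕ → CSpace.{u} n := fun m =>
      if h : m < n then c • matrixBasis.{u} n ⟨⟨m, h⟩⟩ else 0
    have hξ : ∀ m ∉ Finset.range n, ξ m = 0 := by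
      intro m hm
      simp only [Finset.mem_range] at hm
      simp [ξ, hm]
    refine ⟨ξ, summable_of_ne_finset_zero (s := Finset.range n) ?_, fun a => ?_⟩
    · intro m hm
      simp [hξ m hm]
    · have key : (∑ m ∈ Finset.range n, ⟪ξ m, a.1 (ξ m)⟫_ℂ) =
          (n : ℂ)⁻¹ • opTrace n a.1 := by
        rw [opTrace_eq_sum, Finset.sum_range, smul_eq_mul, Finset.mul_sum,
          ← Equiv.sum_comp Equiv.ulift.symm]
        refine Finset.sum_congr rfl fun i _ => ?_
        simp only [ξ, i.2, dif_pos, map_smul, inner_smul_left, inner_smul_right]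
        rw [← mul_assoc, mul_comm c, hc]
        rfl
      change HasSum _ ((n : ℂ)⁻¹ • opTrace n a.1)
      rw [← key]
      refine hasSum_sum_of_ne_finset_zero ?_
      intro m hm
      simp [hξ m hm]

/-! ### Non-commutative polynomials and laws -/

/-- The algebra `ℂ⟨tᵢ : i ∈ I⟩` of non-commutative polynomials. -/
abbrev NCPoly (I : Type u) : Type u := FreeAlgebra ℂ I

namespace NCPoly

variable {I : Type u}

/-- `ℂ⟨tᵢ⟩` with the conjugate scalar multiplication `(c, p) ↦ \bar c p`. -/
def Conj (I : Type u) : Type u := NCPoly I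

instance : Semiring (Conj I) := inferInstanceAs (Semiring (NCPoly I))

instance : Algebra ℂ (Conj I) :=
  ((algebraMap ℂ (NCPoly I)).comp (starRingEnd ℂ)).toAlgebra'
    (fun c x => Algebra.commutes (R := ℂ) (A := NCPoly I) (starRingEnd ℂ c) x)

/-- The ring homomorphism of `ℂ⟨tᵢ⟩` that conjugates all coefficients and fixes every `tᵢ`. -/
def conjCoeff : NCPoly I →+* NCPoly I :=
  (FreeAlgebra.lift ℂ (A := Conj I) (FreeAlgebra.ι ℂ : I → NCPoly I)).toRingHom

/-- The involution `p ↦ p^*` of `ℂ⟨tᵢ⟩`: conjugate-linear, anti-multiplicative, `tᵢ^* = tᵢ`.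
(The involution `star` of `FreeAlgebra` is `ℂ`-linear.) -/
def adj (p : NCPoly I) : NCPoly I := star (conjCoeff p)

@[simp] lemma adj_algebraMap (c : ℂ) :
    adj (algebraMap ℂ (NCPoly I) c) = algebraMap ℂ (NCPoly I) (starRingEnd ℂ c) := by
  have : conjCoeff (algebraMap ℂ (NCPoly I) c) = algebraMap ℂ (NCPoly I) (starRingEnd ℂ c) :=
    (FreeAlgebra.lift ℂ (A := Conj I) (FreeAlgebra.ι ℂ : I → NCPoly I)).commutes c
  rw [adj, this, FreeAlgebra.star_algebraMap]

@[simp] lemma adj_ι (i : I) : adj (FreeAlgebra.ι ℂ i) = FreeAlgebra.ι ℂ i := by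
  have : conjCoeff (FreeAlgebra.ι ℂ i) = FreeAlgebra.ι ℂ i :=
    FreeAlgebra.lift_ι_apply (A := Conj I) (FreeAlgebra.ι ℂ : I → NCPoly I) i
  rw [adj, this, FreeAlgebra.star_ι]

@[simp] lemma adj_add (p q : NCPoly I) : adj (p + q) = adj p + adj q := by simp [adj]

@[simp] lemma adj_mul (p q : NCPoly I) : adj (p * q) = adj q * adj p := by simp [adj]

end NCPoly

namespace TracialWStarAlgebra

variable {I : Type u}

/-- Evaluation `p(x)` of a non-commutative polynomial at a self-adjoint tuple. -/
def evalPoly (M : TracialWStarAlgebra.{u}) (x : I → selfAdjoint M.Elem) : NCPoly I →ₐ[ℂ] M.Elem :=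
  FreeAlgebra.lift ℂ fun i => (x i : M.Elem)

lemma evalPoly_adj (M : TracialWStarAlgebra.{u}) (x : I → selfAdjoint M.Elem) (p : NCPoly I) :
    M.evalPoly x p.adj = star (M.evalPoly x p) := by
  induction p using FreeAlgebra.induction with
  | grade0 c =>
    rw [NCPoly.adj_algebraMap, AlgHom.commutes, AlgHom.commutes, ← algebraMap_star_comm]; rfl
  | grade1 i =>
    rw [NCPoly.adj_ι]
    simp only [evalPoly, FreeAlgebra.lift_ι_apply]
    exact (x i).2.symm
  | mul p q hp hq => simp [hp, hq]
  | add p q hp hq => simp [hp, hq]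

lemma norm_τ_le (M : TracialWStarAlgebra.{u}) (a : M.Elem) : ‖M.τ a‖ ≤ ‖a‖ := by
  obtain ⟨ξ, hs, h⟩ := M.normal
  have h1 : HasSum (fun m => ‖ξ m‖ ^ 2) 1 := by
    have h2 := h 1
    rw [M.unital] at h2
    have h3 : HasSum (fun m => ((‖ξ m‖ ^ 2 : ℝ) : ℂ)) ((1 : ℝ) : ℂ) := by
      convert h2 using 2 with m
      · simp only [OneMemClass.coe_one, one_apply_eq_self]
        rw [inner_self_eq_norm_sq_to_K]
        push_cast
        rfl
      · simp
    exact Complex.hasSum_ofReal.mp h3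
  have h4 : HasSum (fun m => ‖a‖ * ‖ξ m‖ ^ 2) (‖a‖ * 1) := h1.mul_left _
  rw [mul_one] at h4
  refine (h a).norm_le_of_bounded h4 fun m => ?_
  calc ‖⟪ξ m, (a : M.H →L[ℂ] M.H) (ξ m)⟫_ℂ‖ ≤ ‖ξ m‖ * ‖(a : M.H →L[ℂ] M.H) (ξ m)‖ :=
        norm_inner_le_norm _ _
    _ ≤ ‖ξ m‖ * (‖a‖ * ‖ξ m‖) := by
        gcongr
        exact (a : M.H →L[ℂ] M.H).le_opNorm _
    _ = ‖a‖ * ‖ξ m‖ ^ 2 := by ring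

lemma norm2_le (M : TracialWStarAlgebra.{u}) (a : M.Elem) : M.norm2 a ≤ ‖a‖ := by
  refine Real.sqrt_le_iff.mpr ⟨norm_nonneg _, ?_⟩
  calc (M.τ (star a * a)).re ≤ ‖M.τ (star a * a)‖ := Complex.re_le_norm _
    _ ≤ ‖star a * a‖ := M.norm_τ_le _
    _ = ‖a‖ ^ 2 := by rw [CStarRing.norm_star_mul_self, sq]

end TracialWStarAlgebra

/-- `λ` is a non-commutative law of a self-adjoint `I`-tuple with bound `R`: a unital, positive,
tracial linear functional with `|λ(t_{i(1)} ⋯ t_{i(ℓ)})| ≤ R_{i(1)} ⋯ R_{i(ℓ)}`. -/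
structure IsNCLaw {I : Type u} (R : I → ℝ) (l : NCPoly I →ₗ[ℂ] ℂ) : Prop where
  unital : l 1 = 1
  positive : ∀ p : NCPoly I, 0 ≤ l (p.adj * p)
  tracial : ∀ p q : NCPoly I, l (p * q) = l (q * p)
  bounded : ∀ w : List I, ‖l (w.map (FreeAlgebra.ι ℂ)).prod‖ ≤ (w.map R).prod

/-- The space `Σ_R` of non-commutative laws with bound `R`. -/
def NCLaw {I : Type u} (R : I → ℝ) : Type u := {l : NCPoly I →ₗ[ℂ] ℂ // IsNCLaw R l}

/-- The topology of pointwise convergence on `Σ_R`. -/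
instance {I : Type u} (R : I → ℝ) : TopologicalSpace (NCLaw R) :=
  TopologicalSpace.induced (fun l => (l.1 : NCPoly I → ℂ)) inferInstance

namespace NCLaw

variable {I : Type u}

lemma exists_bound (R : I → ℝ) (p : NCPoly I) : ∃ C : ℝ, ∀ l : NCLaw R, ‖l.1 p‖ ≤ C := by
  set S : Set (NCPoly I) := Set.range fun w : List I => (w.map (FreeAlgebra.ι ℂ)).prod with hS
  have hSS : ∀ a ∈ S, ∀ b ∈ S, a * b ∈ S := by
    rintro _ ⟨v, rfl⟩ _ ⟨w, rfl⟩
    exact ⟨v ++ w, by simp⟩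
  have h1 : (1 : NCPoly I) ∈ Submodule.span ℂ S := Submodule.subset_span ⟨[], by simp⟩
  have hp : p ∈ Submodule.span ℂ S := by
    induction p using FreeAlgebra.induction with
    | grade0 c =>
      rw [Algebra.algebraMap_eq_smul_one]
      exact Submodule.smul_mem _ _ h1
    | grade1 i => exact Submodule.subset_span ⟨[i], by simp⟩
    | mul p q hp hq =>
      have h2 : ∀ a ∈ S, a * q ∈ Submodule.span ℂ S := fun a ha => by
        induction hq using Submodule.span_induction with
        | mem b hb => exact Submodule.subset_span (hSS a ha b hb)
        | zero => simp
        | add b c _ _ hb hc => rw [mul_add]; exact Submodule.add_mem _ hb hc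
        | smul c b _ hb => rw [mul_smul_comm]; exact Submodule.smul_mem _ _ hb
      induction hp using Submodule.span_induction with
      | mem a ha => exact h2 a ha
      | zero => simp
      | add b c _ _ hb hc => rw [add_mul]; exact Submodule.add_mem _ hb hc
      | smul c b _ hb => rw [smul_mul_assoc]; exact Submodule.smul_mem _ _ hb
    | add p q hp hq => exact Submodule.add_mem _ hp hq
  induction hp using Submodule.span_induction with
  | mem q hq =>
    obtain ⟨w, rfl⟩ := hq
    exact ⟨_, fun l => l.2.bounded w⟩
  | zero => exact ⟨0, fun l => by simp⟩
  | add q r _ _ hq hr =>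
    obtain ⟨C, hC⟩ := hq
    obtain ⟨D, hD⟩ := hr
    exact ⟨C + D, fun l => by
      rw [map_add]
      exact (norm_add_le _ _).trans (add_le_add (hC l) (hD l))⟩
  | smul c q _ hq =>
    obtain ⟨C, hC⟩ := hq
    exact ⟨‖c‖ * C, fun l => by
      rw [map_smul, norm_smul]
      exact mul_le_mul_of_nonneg_left (hC l) (norm_nonneg _)⟩

lemma range_coe (R : I → ℝ) :
    Set.range (fun l : NCLaw R => (l.1 : NCPoly I → ℂ)) =
      {g | ((∀ p q, g (p + q) = g p + g q) ∧ (∀ (c : ℂ) p, g (c • p) = c • g p)) ∧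
        (g 1 = 1 ∧ (∀ p : NCPoly I, 0 ≤ g (p.adj * p)) ∧ (∀ p q, g (p * q) = g (q * p)) ∧
        ∀ w : List I, ‖g (w.map (FreeAlgebra.ι ℂ)).prod‖ ≤ (w.map R).prod)} := by
  ext g
  constructor
  · rintro ⟨l, rfl⟩
    exact ⟨⟨map_add l.1, map_smul l.1⟩, l.2.unital, l.2.positive, l.2.tracial, l.2.bounded⟩
  · rintro ⟨⟨h1, h2⟩, h3, h4, h5, h6⟩
    exact ⟨⟨⟨⟨g, h1⟩, h2⟩, ⟨h3, h4, h5, h6⟩⟩, rfl⟩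

instance (R : I → ℝ) : CompactSpace (NCLaw R) := by
  have hind : Topology.IsInducing (fun l : NCLaw R => (l.1 : NCPoly I → ℂ)) := ⟨rfl⟩
  refine ⟨hind.isCompact_iff.mpr ?_⟩
  rw [Set.image_univ]
  choose C hC using exists_bound R
  refine IsCompact.of_isClosed_subset
    (isCompact_univ_pi fun p => isCompact_closedBall (0 : ℂ) (C p)) ?_ ?_
  · rw [range_coe]
    have hall {ι : Type u} {q : ι → (NCPoly I → ℂ) → Prop} (h : ∀ i, IsClosed {g | q i g}) :
        IsClosed {g | ∀ i, q i g} := by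
      have : {g | ∀ i, q i g} = ⋂ i, {g | q i g} := by ext; simp
      rw [this]
      exact isClosed_iInter h
    have hallc {q : ℂ → (NCPoly I → ℂ) → Prop} (h : ∀ i, IsClosed {g | q i g}) :
        IsClosed {g | ∀ i, q i g} := by
      have : {g | ∀ i, q i g} = ⋂ i, {g | q i g} := by ext; simp
      rw [this]
      exact isClosed_iInter h
    refine IsClosed.and (IsClosed.and ?_ ?_) (IsClosed.and ?_ (IsClosed.and ?_ (IsClosed.and ?_ ?_)))
    · exact hall fun p => hall fun q => isClosed_eq (by fun_prop) (by fun_prop)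
    · exact hallc fun c => hall fun q => isClosed_eq (by fun_prop) (by fun_prop)
    · exact isClosed_eq (by fun_prop) (by fun_prop)
    · exact hall fun p => isClosed_le (by fun_prop) (by fun_prop)
    · exact hall fun p => hall fun q => isClosed_eq (by fun_prop) (by fun_prop)
    · exact hall fun w => isClosed_le (by fun_prop) (by fun_prop)
  · rintro _ ⟨l, rfl⟩ p _
    simpa using hC p l

end NCLaw

namespace TracialWStarAlgebra

variable {I : Type u}

/-- The law `λ_x : p ↦ τ(p(x))` of a self-adjoint tuple with `‖xᵢ‖ ≤ Rᵢ`, as a point of `Σ_R`. -/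
def law (M : TracialWStarAlgebra.{u}) {R : I → ℝ} (x : I → selfAdjoint M.Elem)
    (hx : ∀ i, ‖(x i : M.Elem)‖ ≤ R i) : NCLaw R :=
  ⟨M.τ ∘ₗ (M.evalPoly x).toLinearMap, by
    refine ⟨?_, ?_, ?_, ?_⟩
    · simpa using M.unital
    · intro p
      simpa [M.evalPoly_adj] using M.positive (M.evalPoly x p)
    · intro p q
      simpa using M.tracial (M.evalPoly x p) (M.evalPoly x q)
    · intro w
      refine (M.norm_τ_le _).trans ?_
      change ‖M.evalPoly x (w.map (FreeAlgebra.ι ℂ)).prod‖ ≤ _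
      induction w with
      | nil =>
        simp only [List.map_nil, List.prod_nil, map_one]
        exact ContinuousLinearMap.norm_id_le
      | cons i w ih =>
        simp only [List.map_cons, List.prod_cons, map_mul]
        refine (norm_mul_le _ _).trans ?_
        refine mul_le_mul ?_ ih (norm_nonneg _) ((norm_nonneg _).trans (hx i))
        simpa [evalPoly] using hx i⟩

/-- The evaluation map `ev_x : C(Σ_R) ⊗ ℂ⟨tᵢ⟩ → M`, `φ ⊗ p ↦ φ(λ_x) p(x)`. -/
def ev (M : TracialWStarAlgebra.{u}) {R : I → ℝ} (x : I → selfAdjoint M.Elem)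
    (hx : ∀ i, ‖(x i : M.Elem)‖ ≤ R i) : C(NCLaw R, ℂ) ⊗[ℂ] NCPoly I →ₗ[ℂ] M.Elem :=
  TensorProduct.lift (LinearMap.mk₂ ℂ (fun φ p => φ (M.law x hx) • M.evalPoly x p)
    (fun φ ψ p => by simp [add_smul]) (fun c φ p => by simp [mul_smul])
    (fun φ p q => by simp) (fun c φ p => by rw [map_smul, smul_comm]))

@[simp] lemma ev_tmul (M : TracialWStarAlgebra.{u}) {R : I → ℝ} (x : I → selfAdjoint M.Elem)
    (hx : ∀ i, ‖(x i : M.Elem)‖ ≤ R i) (φ : C(NCLaw R, ℂ)) (p : NCPoly I) :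
    M.ev x hx (φ ⊗ₜ p) = φ (M.law x hx) • M.evalPoly x p := rfl

end TracialWStarAlgebra

/-! ### The function spaces `F_{R,2}`, `F_{R,∞}` and `F_{R,R'}` -/

/-- The space `A_R = C(Σ_R) ⊗ ℂ⟨tᵢ⟩` with the seminorm `‖·‖_{R,2}`. -/
def FunA {I : Type u} (R : I → ℝ) : Type u := C(NCLaw R, ℂ) ⊗[ℂ] NCPoly I

namespace FunA

variable {I : Type u} {R : I → ℝ}

instance : AddCommGroup (FunA R) := inferInstanceAs (AddCommGroup (C(NCLaw R, ℂ) ⊗[ℂ] NCPoly I))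

/-- The evaluation `f(x)` of `f ∈ A_R`. -/
def eval (M : TracialWStarAlgebra.{u}) (x : I → selfAdjoint M.Elem)
    (hx : ∀ i, ‖(x i : M.Elem)‖ ≤ R i) : FunA R →+ M.Elem :=
  (M.ev x hx).toAddMonoidHom

/-- The values `‖f(x)‖₂`, over all tracial `W^*`-algebras `M` and all self-adjoint tuples `x` in `M`
with `‖xᵢ‖ ≤ Rᵢ`. -/
def values (f : FunA R) : Set ℝ :=
  {r | ∃ (M : TracialWStarAlgebra.{u}) (x : I → selfAdjoint M.Elem)
    (hx : ∀ i, ‖(x i : M.Elem)‖ ≤ R i), r = ‖M.toL2 (eval M x hx f)‖}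

lemma bddAbove_values (f : FunA R) : BddAbove (values f) := by
  suffices h : ∃ C : ℝ, ∀ (M : TracialWStarAlgebra.{u}) (x : I → selfAdjoint M.Elem)
      (hx : ∀ i, ‖(x i : M.Elem)‖ ≤ R i), ‖M.toL2 (M.ev x hx f)‖ ≤ C by
    obtain ⟨C, hC⟩ := h
    exact ⟨C, by rintro _ ⟨M, x, hx, rfl⟩; exact hC M x hx⟩
  induction f using TensorProduct.induction_on with
  | zero => exact ⟨0, fun M x hx => by simp⟩
  | add f g hf hg =>
    obtain ⟨C, hC⟩ := hf
    obtain ⟨D, hD⟩ := hg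
    exact ⟨C + D, fun M x hx => by
      rw [map_add, map_add]
      exact (norm_add_le _ _).trans (add_le_add (hC M x hx) (hD M x hx))⟩
  | tmul φ p =>
    obtain ⟨C, hC⟩ := NCLaw.exists_bound R (p.adj * p)
    refine ⟨‖φ‖ * Real.sqrt C, fun M x hx => ?_⟩
    rw [TracialWStarAlgebra.ev_tmul, map_smul, norm_smul, M.norm_toL2]
    refine mul_le_mul (φ.norm_coe_le_norm _) (Real.sqrt_le_sqrt ?_) (Real.sqrt_nonneg _)
      (norm_nonneg _)
    have := hC (M.law x hx)
    rw [← M.evalPoly_adj, ← map_mul]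
    exact (Complex.re_le_norm _).trans this

/-- The seminorm `‖f‖_{R,2} = sup ‖f(x)‖₂` over all tracial `W^*`-algebras and all self-adjoint
tuples `x` with `‖xᵢ‖ ≤ Rᵢ`. -/
def seminorm : AddGroupSeminorm (FunA R) where
  toFun f := sSup (values f)
  map_zero' := by
    refine le_antisymm (Real.sSup_le ?_ le_rfl) (Real.sSup_nonneg ?_)
    · rintro _ ⟨M, x, hx, rfl⟩; simp
    · rintro _ ⟨M, x, hx, rfl⟩; exact norm_nonneg _
  add_le' f g := by
    have h0 (f : FunA R) : 0 ≤ sSup (values f) :=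
      Real.sSup_nonneg (by rintro _ ⟨M, x, hx, rfl⟩; exact norm_nonneg _)
    refine Real.sSup_le ?_ (add_nonneg (h0 f) (h0 g))
    rintro _ ⟨M, x, hx, rfl⟩
    rw [map_add, map_add]
    exact (norm_add_le _ _).trans (add_le_add (le_csSup (bddAbove_values f) ⟨M, x, hx, rfl⟩)
      (le_csSup (bddAbove_values g) ⟨M, x, hx, rfl⟩))
  neg' f := by
    congr 1
    ext r
    simp [values]

instance : SeminormedAddCommGroup (FunA R) := seminorm.toSeminormedAddCommGroup

lemma norm_eval_le (M : TracialWStarAlgebra.{u}) (x : I → selfAdjoint M.Elem)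
    (hx : ∀ i, ‖(x i : M.Elem)‖ ≤ R i) (f : FunA R) : ‖M.toL2 (eval M x hx f)‖ ≤ ‖f‖ :=
  le_csSup (bddAbove_values f) ⟨M, x, hx, rfl⟩

end FunA

/-- The space `F_{R,2}`: the (Hausdorff) completion of `A_R` for `‖·‖_{R,2}`. -/
abbrev Fun2 {I : Type u} (R : I → ℝ) : Type u := UniformSpace.Completion (FunA R)

namespace Fun2

variable {I : Type u} {R : I → ℝ}

/-- The evaluation `f(x) ∈ L²(M)` of `f ∈ F_{R,2}`: the continuous extension of the evaluation of
`A_R`. -/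
def eval (M : TracialWStarAlgebra.{u}) (x : I → selfAdjoint M.Elem)
    (hx : ∀ i, ‖(x i : M.Elem)‖ ≤ R i) : Fun2 R → M.L2 :=
  UniformSpace.Completion.extension fun f : FunA R => M.toL2 (FunA.eval M x hx f)

lemma eval_coe (M : TracialWStarAlgebra.{u}) (x : I → selfAdjoint M.Elem)
    (hx : ∀ i, ‖(x i : M.Elem)‖ ≤ R i) (f : FunA R) :
    eval M x hx (f : Fun2 R) = M.toL2 (FunA.eval M x hx f) := by
  refine UniformSpace.Completion.extension_coe ?_ f
  refine AddMonoidHomClass.uniformContinuous_of_bound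
    (M.toL2.toAddMonoidHom.comp (FunA.eval M x hx)) 1 fun f => ?_
  rw [one_mul]
  exact FunA.norm_eval_le M x hx f

/-- `f` is a self-adjoint element of `F_{R,∞}` with `‖f‖_{R,∞} ≤ C`: for every tracial `W^*`-algebra
`M` and every self-adjoint tuple `x` in `M` with `‖xᵢ‖ ≤ Rᵢ`, the vector `f(x) ∈ L²(M)` is a
self-adjoint element of `M` of operator norm at most `C`. -/
def IsSelfAdjointBoundedBy (f : Fun2 R) (C : ℝ) : Prop :=
  ∀ (M : TracialWStarAlgebra.{u}) (x : I → selfAdjoint M.Elem)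
    (hx : ∀ i, ‖(x i : M.Elem)‖ ≤ R i),
    ∃ a : selfAdjoint M.Elem, M.toL2 a = eval M x hx f ∧ ‖(a : M.Elem)‖ ≤ C

end Fun2

/-- The space `F_{R,R'}` of `I'`-tuples of self-adjoint elements `fᵢ` of `F_{R,∞}` with
`‖fᵢ‖_{R,∞} ≤ R'ᵢ`. -/
def FunTuple {I I' : Type u} (R : I → ℝ) (R' : I' → ℝ) : Type u :=
  {f : I' → Fun2 R // ∀ i, (f i).IsSelfAdjointBoundedBy (R' i)}

/-- The evaluation `f(x) = (fᵢ(x))ᵢ`, a self-adjoint tuple in `M`. -/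
def FunTuple.eval {I I' : Type u} {R : I → ℝ} {R' : I' → ℝ} (f : FunTuple R R')
    (M : TracialWStarAlgebra.{u}) (x : I → selfAdjoint M.Elem)
    (hx : ∀ i, ‖(x i : M.Elem)‖ ≤ R i) (i : I') : selfAdjoint M.Elem :=
  (f.2 i M x hx).choose

lemma FunTuple.toL2_eval {I I' : Type u} {R : I → ℝ} {R' : I' → ℝ} (f : FunTuple R R')
    (M : TracialWStarAlgebra.{u}) (x : I → selfAdjoint M.Elem)
    (hx : ∀ i, ‖(x i : M.Elem)‖ ≤ R i) (i : I') :
    M.toL2 (f.eval M x hx i) = Fun2.eval M x hx (f.1 i) :=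
  (f.2 i M x hx).choose_spec.1

/-! ### Random matrix models -/

/-- The space `M_n(ℂ)_sa^I` with the product topology. -/
def MatTuple (I : Type u) (n : ℕ) [NeZero n] : Type u := I → selfAdjoint (matrixAlgebra.{u} n).Elem

instance (I : Type u) (n : ℕ) [NeZero n] : TopologicalSpace (MatTuple I n) :=
  inferInstanceAs (TopologicalSpace (I → selfAdjoint (matrixAlgebra.{u} n).Elem))

/-- The Borel `σ`-algebra of the product topology. -/
instance (I : Type u) (n : ℕ) [NeZero n] : MeasurableSpace (MatTuple I n) := borel _

instance (I : Type u) (n : ℕ) [NeZero n] : BorelSpace (MatTuple I n) := ⟨rfl⟩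

namespace MatTuple

variable {I I' : Type u} {n : ℕ} [NeZero n]

/-- The set `{A : ‖Aᵢ‖ ≤ Rᵢ for all i}`. -/
def box (R : I → ℝ) : Set (MatTuple I n) :=
  {A | ∀ i, ‖(A i : (matrixAlgebra.{u} n).Elem)‖ ≤ R i}

/-- The `(F, ε)`-neighbourhood `N_{F,ε}(Ω)`. -/
def nhd (F : Finset I) (ε : ℝ) (Ω : Set (MatTuple I n)) : Set (MatTuple I n) :=
  {B | ∃ A ∈ Ω, ∀ i ∈ F, (matrixAlgebra.{u} n).norm2 (A i - B i) < ε}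

/-- The concentration function `α_μ(F, ε) = sup {μ(N_{F,ε}(Ω)ᶜ) : Ω Borel, μ(Ω) ≥ 1/2}`. -/
def concentrationFunction (μ : Measure (MatTuple I n)) (F : Finset I) (ε : ℝ) : ℝ≥0∞ :=
  ⨆ (Ω : Set (MatTuple I n)) (_ : MeasurableSet Ω) (_ : 1 / 2 ≤ μ Ω), μ (nhd F ε Ω)ᶜ

open Classical in
/-- The map `A ↦ f(A)` on `{A : ‖Aᵢ‖ ≤ Rᵢ}`, extended by `0`. -/
def apply {R : I → ℝ} {R' : I' → ℝ} (f : FunTuple R R') (A : MatTuple I n) : MatTuple I' n :=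
  if hA : A ∈ box R then f.eval (matrixAlgebra n) A hA else fun _ => 0

/-- The push-forward `f_* μ` of a probability measure `μ` supported on `{A : ‖Aᵢ‖ ≤ Rᵢ}`. -/
def pushforward {R : I → ℝ} {R' : I' → ℝ} (f : FunTuple R R') (μ : Measure (MatTuple I n)) :
    Measure (MatTuple I' n) :=
  μ.map (apply f)

end MatTuple

/-- Exponential concentration at scale `n(k)²`: for every finite `F` and `ε > 0`,
`limsup_k n(k)⁻² log α_{μ^(k)}(F, ε) < 0`, where `log 0 = -∞`. -/
def HasExponentialConcentration {I : Type u} (n : ℕ → ℕ) [∀ k, NeZero (n k)]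
    (μ : ∀ k, Measure (MatTuple I (n k))) : Prop :=
  ∀ (F : Finset I) (ε : ℝ), 0 < ε →
    limsup (fun k => ((1 / (n k : ℝ) ^ 2 : ℝ) : EReal) *
      ENNReal.log (MatTuple.concentrationFunction (μ k) F ε)) atTop < 0

/-- Borel probability measures `μ^(k)` on `M_{n(k)}(ℂ)_sa^I` that satisfy the following with respect
to `P ⊆ M`, the self-adjoint tuple `x` in `M` and the bounds `R`:
(1) `μ^(k)` is supported on `{A : ‖Aᵢ‖ ≤ Rᵢ}`;
(2) `τ_{n(k)}(p(X^(k))) → τ(p(x))` in probability for every non-commutative polynomial `p`;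
(3) exponential concentration at scale `n(k)²`;
(4) `‖E[p(X^(k))]‖₂ → ‖E_P[p(x)]‖₂` for every non-commutative polynomial `p`. -/
structure IsRandomMatrixModel {I : Type u} (M : TracialWStarAlgebra.{u})
    (P : VonNeumannAlgebra M.H) (x : I → selfAdjoint M.Elem) (R : I → ℝ)
    (n : ℕ → ℕ) [∀ k, NeZero (n k)] (μ : ∀ k, Measure (MatTuple I (n k))) : Prop where
  isProbabilityMeasure : ∀ k, IsProbabilityMeasure (μ k)
  operator_norm_bound : ∀ k, μ k (MatTuple.box R)ᶜ = 0
  convergence_in_law : ∀ p : NCPoly I, ∀ ε : ℝ, 0 < ε →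
    Tendsto (fun k => μ k {A | ε ≤ ‖(matrixAlgebra.{u} (n k)).τ
      ((matrixAlgebra.{u} (n k)).evalPoly A p) - M.τ (M.evalPoly x p)‖}) atTop (𝓝 0)
  exponential_concentration : HasExponentialConcentration n μ
  external_averaging : ∀ p : NCPoly I,
    Tendsto (fun k => (matrixAlgebra.{u} (n k)).norm2
      (∫ A, (matrixAlgebra.{u} (n k)).evalPoly A p ∂(μ k))) atTop
      (𝓝 ‖M.condExp P (M.toL2 (M.evalPoly x p))‖)

end

/-!
Every `f` in `F_{R,R'}` is uniformly continuous for the `2`-norms, and near the law of `x` it is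
`2`-close to a single non-commutative polynomial. So concentration of measure passes through `f`,
and convergence in law and external averaging pass from `x` to `y = f(x)`; the limit obtained for
external averaging is `‖E_P[q(y)]‖₂`, which the commuting square condition turns into
`‖E_{P ∩ Q}[q(y)]‖₂`.

For the independence of generators, every self-adjoint `a` in `W^*(x)` with `‖a‖ ≤ r` is `f(x)` for
some `f` bounded by `r`. Write `a = 2rb / (1 + b²)` with `b` self-adjoint and approximate `b` in
`2`-norm by polynomials in `x`. Differences of consecutive polynomials are small at `x` only; they
become uniformly small when they are multiplied by continuous cut-off functions of the law. Their
sums need not converge to bounded operators, but `t ↦ 2rt / (1 + t²)` is bounded by `r` and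
Lipschitz for the `2`-norms, so applying it gives a limit in `F_{R,2}` with values in `M`.
-/

noncomputable section

section Amplification

variable {𝕜 H ι : Type*} [RCLike 𝕜] [NormedAddCommGroup H] [InnerProductSpace 𝕜 H]

/-- The diagonal operator `T ⊕ T ⊕ ⋯` on `ℓ²(ι, H)`. -/
def amplify : (H →L[𝕜] H) →ₐ[𝕜] (lp (fun _ : ι => H) 2 →L[𝕜] lp (fun _ : ι => H) 2) where
  toFun T := lp.mapCLM 2 (fun _ => T) (norm_nonneg T) fun _ => le_rfl
  map_one' := rfl
  map_mul' _ _ := rfl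
  map_zero' := rfl
  map_add' _ _ := rfl
  commutes' _ := rfl

lemma norm_amplify_le (T : H →L[𝕜] H) :
    ‖(amplify T : lp (fun _ : ι => H) 2 →L[𝕜] lp (fun _ : ι => H) 2)‖ ≤ ‖T‖ :=
  lp.norm_mapCLM_le 2 _ (norm_nonneg T) fun _ => le_rfl

lemma amplify_single [DecidableEq ι] (T : H →L[𝕜] H) (j : ι) (u : H) :
    amplify T (lp.single 2 j u) = lp.single 2 j (T u) := by
  ext m
  exact Pi.apply_single (fun _ => T) (fun _ => map_zero T) j u m

lemma commute_amplify_of_mem_centralizer_centralizer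
    {X : lp (fun _ : ι => H) 2 →L[𝕜] lp (fun _ : ι => H) 2} {S : Set (H →L[𝕜] H)}
    (hX : ∀ T ∈ S, Commute X (amplify T)) {T : H →L[𝕜] H}
    (hT : T ∈ Set.centralizer (Set.centralizer S)) : Commute X (amplify T) := by
  classical
  let entry (m j : ι) : H →L[𝕜] H := (lp.evalCLM 𝕜 (fun _ : ι => H) 2 m).comp
    (X.comp (lp.singleContinuousLinearMap 𝕜 (fun _ : ι => H) 2 j))
  have h_sum (v : lp (fun _ : ι => H) 2) (m : ι) : HasSum (fun j => entry m j (v j)) (X v m) :=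
    ((lp.evalCLM 𝕜 (fun _ : ι => H) 2 m).comp X).hasSum (lp.hasSum_single (by simp) v)
  have h_entry (m j : ι) : entry m j ∈ Set.centralizer S := fun T hT => by
    ext u
    change amplify T (X (lp.single 2 j u)) m = X (lp.single 2 j (T u)) m
    rw [← amplify_single]
    exact congrArg (fun v : lp (fun _ : ι => H) 2 => v m) (DFunLike.congr_fun (hX T hT) _).symm
  ext v m
  refine (h_sum (amplify T v) m).unique ((T.hasSum (h_sum v m)).congr_fun fun j => ?_)
  exact DFunLike.congr_fun (hT (entry m j) (h_entry m j)) (v j)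

variable [CompleteSpace H]

lemma isSelfAdjoint_amplify {T : H →L[𝕜] H} (hT : IsSelfAdjoint T) :
    IsSelfAdjoint (amplify T : lp (fun _ : ι => H) 2 →L[𝕜] lp (fun _ : ι => H) 2) := by
  refine ContinuousLinearMap.isSelfAdjoint_iff_isSymmetric.mpr fun v w => ?_
  change inner 𝕜 (amplify T v) w = inner 𝕜 v (amplify T w)
  rw [lp.inner_eq_tsum, lp.inner_eq_tsum]
  exact tsum_congr fun m => ContinuousLinearMap.isSelfAdjoint_iff_isSymmetric.mp hT _ _

lemma commute_starProjection_of_isSelfAdjoint {T : H →L[𝕜] H} (hT : IsSelfAdjoint T)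
    {K : Submodule 𝕜 H} [K.HasOrthogonalProjection] (hK : ∀ v ∈ K, T v ∈ K) :
    Commute K.starProjection T := by
  ext v
  refine Submodule.eq_starProjection_of_mem_of_inner_eq_zero
    (hK _ (Submodule.starProjection_apply_mem K v)) fun w hw => ?_
  change inner 𝕜 (T v - T (K.starProjection v)) w = 0
  rw [← map_sub]
  refine (ContinuousLinearMap.isSelfAdjoint_iff_isSymmetric.mp hT _ _).trans ?_
  exact Submodule.inner_left_of_mem_orthogonal (hK w hw)
    (Submodule.sub_starProjection_mem_orthogonal v)

end Amplification

namespace TracialWStarAlgebra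

section TwoNorm

variable (M : TracialWStarAlgebra.{u})

lemma norm_one_le : ‖(1 : M.Elem)‖ ≤ 1 := ContinuousLinearMap.norm_id_le

lemma norm_algebraMap_le (c : ℂ) : ‖algebraMap ℂ M.Elem c‖ ≤ ‖c‖ := by
  rw [Algebra.algebraMap_eq_smul_one]
  exact (norm_smul_le _ _).trans (mul_le_of_le_one_right (norm_nonneg c) M.norm_one_le)

lemma norm_toL2_le (a : M.Elem) : ‖M.toL2 a‖ ≤ ‖a‖ :=
  (M.norm_toL2 a).trans_le (M.norm2_le a)

/-- The map `M → L²(M)`, as a bounded operator for the operator norm of `M`. -/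
def toL2CLM : M.Elem →L[ℂ] M.L2 :=
  M.toL2.mkContinuous 1 fun a => by simpa only [one_mul] using M.norm_toL2_le a

@[simp] lemma toL2CLM_apply (a : M.Elem) : M.toL2CLM a = M.toL2 a := rfl

lemma denseRange_toL2 : DenseRange M.toL2 :=
  UniformSpace.Completion.denseRange_coe (α := M.PreL2)

lemma norm_τ_le_norm_toL2 (a : M.Elem) : ‖M.τ a‖ ≤ ‖M.toL2 a‖ :=
  calc ‖M.τ a‖ = ‖⟪M.toL2 1, M.toL2 a⟫_ℂ‖ := by rw [inner_toL2, star_one, one_mul]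
    _ ≤ ‖M.toL2 1‖ * ‖M.toL2 a‖ := norm_inner_le_norm _ _
    _ = ‖M.toL2 a‖ := by simp [norm_toL2, norm2, M.unital]

lemma norm_toL2_star (a : M.Elem) : ‖M.toL2 (star a)‖ = ‖M.toL2 a‖ := by
  rw [norm_toL2, norm_toL2, norm2, norm2, star_star, M.tracial]

lemma hasSum_norm_sq {ξ : ℕ → M.H}
    (h : ∀ a : M.Elem, HasSum (fun m => ⟪ξ m, (a : M.H →L[ℂ] M.H) (ξ m)⟫_ℂ) (M.τ a))
    (a : M.Elem) :
    HasSum (fun m => ‖(a : M.H →L[ℂ] M.H) (ξ m)‖ ^ 2) (‖M.toL2 a‖ ^ 2) := by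
  have h_norm : ((‖M.toL2 a‖ ^ 2 : ℝ) : ℂ) = M.τ (star a * a) := by
    rw [← inner_toL2, inner_self_eq_norm_sq_to_K]
    norm_cast
  rw [← Complex.hasSum_ofReal, h_norm]
  convert h (star a * a) using 2 with m
  change _ = ⟪ξ m, ContinuousLinearMap.adjoint (a : M.H →L[ℂ] M.H) ((a : M.H →L[ℂ] M.H) (ξ m))⟫_ℂ
  rw [ContinuousLinearMap.adjoint_inner_right, inner_self_eq_norm_sq_to_K]
  norm_cast

lemma exists_norm_toL2_eq_norm_amplify :
    ∃ ξ : lp (fun _ : ℕ => M.H) 2, ∀ a : M.Elem,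
      ‖M.toL2 a‖ = ‖amplify (a : M.H →L[ℂ] M.H) ξ‖ := by
  obtain ⟨ξ, h_summable, hξ⟩ := M.normal
  let v : lp (fun _ : ℕ => M.H) 2 := ⟨ξ, memℓp_gen (by simpa using h_summable)⟩
  have h_norm (w : lp (fun _ : ℕ => M.H) 2) : HasSum (fun m => ‖w m‖ ^ 2) (‖w‖ ^ 2) := by
    simpa using lp.hasSum_norm (p := 2) (by simp) w
  exact ⟨v, fun a => (sq_eq_sq₀ (norm_nonneg _) (norm_nonneg _)).mp
    ((M.hasSum_norm_sq hξ a).unique (h_norm (amplify (a : M.H →L[ℂ] M.H) v)))⟩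

lemma norm_toL2_mul_le_left (a b : M.Elem) : ‖M.toL2 (a * b)‖ ≤ ‖a‖ * ‖M.toL2 b‖ := by
  obtain ⟨ξ, hξ⟩ := M.exists_norm_toL2_eq_norm_amplify
  calc ‖M.toL2 (a * b)‖ = ‖amplify (a : M.H →L[ℂ] M.H) (amplify (b : M.H →L[ℂ] M.H) ξ)‖ := hξ _
    _ ≤ ‖a‖ * ‖amplify (b : M.H →L[ℂ] M.H) ξ‖ :=
      ContinuousLinearMap.le_of_opNorm_le _ (norm_amplify_le _) _
    _ = _ := by rw [hξ]

lemma norm_toL2_mul_le_right (a b : M.Elem) : ‖M.toL2 (a * b)‖ ≤ ‖M.toL2 a‖ * ‖b‖ :=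
  calc ‖M.toL2 (a * b)‖ = ‖M.toL2 (star b * star a)‖ := by rw [← star_mul, norm_toL2_star]
    _ ≤ ‖star b‖ * ‖M.toL2 (star a)‖ := M.norm_toL2_mul_le_left _ _
    _ = ‖M.toL2 a‖ * ‖b‖ := by rw [norm_toL2_star, norm_star, mul_comm]

lemma dist_toL2 (a b : M.Elem) : dist (M.toL2 a) (M.toL2 b) = ‖M.toL2 (a - b)‖ := by
  rw [dist_eq_norm, map_sub]

lemma dist_toL2_le (a b : M.Elem) : dist (M.toL2 a) (M.toL2 b) ≤ ‖a - b‖ :=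
  (M.dist_toL2 a b).trans_le (M.norm_toL2_le _)

lemma dist_τ_le (a b : M.Elem) : dist (M.τ a) (M.τ b) ≤ dist (M.toL2 a) (M.toL2 b) := by
  rw [dist_eq_norm, ← map_sub, dist_toL2]
  exact M.norm_τ_le_norm_toL2 _

lemma dist_toL2_add_le (a b c d : M.Elem) :
    dist (M.toL2 (a + b)) (M.toL2 (c + d)) ≤
      dist (M.toL2 a) (M.toL2 c) + dist (M.toL2 b) (M.toL2 d) := by
  simpa only [map_add] using dist_add_add_le _ _ _ _

lemma dist_toL2_mul_le (a b c d : M.Elem) :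
    dist (M.toL2 (a * b)) (M.toL2 (c * d)) ≤
      ‖b‖ * dist (M.toL2 a) (M.toL2 c) + ‖c‖ * dist (M.toL2 b) (M.toL2 d) := by
  have h_split : a * b - c * d = (a - c) * b + c * (b - d) := by noncomm_ring
  rw [dist_toL2, dist_toL2, dist_toL2, h_split, map_add, mul_comm ‖b‖]
  exact (norm_add_le _ _).trans
    (add_le_add (M.norm_toL2_mul_le_right _ _) (M.norm_toL2_mul_le_left _ _))

end TwoNorm

section Subalgebras

variable (M : TracialWStarAlgebra.{u}) {I : Type u}

@[simp] lemma evalPoly_ι (x : I → selfAdjoint M.Elem) (i : I) :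
    M.evalPoly x (FreeAlgebra.ι ℂ i) = x i := by simp [evalPoly]

/-- The inclusion of a `W^*`-subalgebra. -/
def incl (Q : VonNeumannAlgebra M.H) (hQ : Q ≤ M.alg) : (M.sub Q hQ).Elem →⋆ₐ[ℂ] M.Elem :=
  StarSubalgebra.inclusion (S₁ := Q.toStarSubalgebra) (S₂ := M.alg.toStarSubalgebra) hQ

lemma incl_evalPoly_generators (y : I → selfAdjoint M.Elem) (q : NCPoly I) :
    M.incl (M.wStar y) (M.wStar_le y) ((M.generated y).evalPoly (M.generators y) q) =
      M.evalPoly y q := by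
  suffices h : (M.incl (M.wStar y) (M.wStar_le y)).toAlgHom.comp
      ((M.generated y).evalPoly (M.generators y)) = M.evalPoly y from DFunLike.congr_fun h q
  refine FreeAlgebra.hom_ext (funext fun i => ?_)
  change M.incl _ _ ((M.generated y).evalPoly (M.generators y) (FreeAlgebra.ι ℂ i)) =
    M.evalPoly y (FreeAlgebra.ι ℂ i)
  simp only [evalPoly_ι]
  rfl

lemma evalPoly_mem_wStar (y : I → selfAdjoint M.Elem) (q : NCPoly I) :
    (M.evalPoly y q : M.H →L[ℂ] M.H) ∈ M.wStar y :=
  M.incl_evalPoly_generators y q ▸ ((M.generated y).evalPoly (M.generators y) q).2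

lemma norm_toL2_incl (Q : VonNeumannAlgebra M.H) (hQ : Q ≤ M.alg) (a : (M.sub Q hQ).Elem) :
    ‖M.toL2 (M.incl Q hQ a)‖ = ‖(M.sub Q hQ).toL2 a‖ := by
  rw [norm_toL2, norm_toL2]
  rfl

/-- The isometric embedding `L²(Q) → L²(M)` that extends the inclusion of a `W^*`-subalgebra. -/
def inclL2 (Q : VonNeumannAlgebra M.H) (hQ : Q ≤ M.alg) : (M.sub Q hQ).L2 →ₗᵢ[ℂ] M.L2 where
  __ := (M.toL2 ∘ₗ (M.incl Q hQ).toLinearMap).extendOfNorm (M.sub Q hQ).toL2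
  norm_map' v := by
    refine (M.sub Q hQ).denseRange_toL2.induction_on v
      (isClosed_eq (by fun_prop) (by fun_prop)) fun a => ?_
    refine (congrArg norm (LinearMap.extendOfNorm_eq (M.sub Q hQ).denseRange_toL2
      ⟨1, fun b => ?_⟩ a)).trans (M.norm_toL2_incl Q hQ a)
    exact (M.norm_toL2_incl Q hQ b).trans_le (one_mul _).ge

lemma inclL2_toL2 (Q : VonNeumannAlgebra M.H) (hQ : Q ≤ M.alg) (a : (M.sub Q hQ).Elem) :
    M.inclL2 Q hQ ((M.sub Q hQ).toL2 a) = M.toL2 (M.incl Q hQ a) :=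
  LinearMap.extendOfNorm_eq (M.sub Q hQ).denseRange_toL2
    ⟨1, fun b => (M.norm_toL2_incl Q hQ b).trans_le (one_mul _).ge⟩ a

lemma map_inclL2_L2Sub (Q : VonNeumannAlgebra M.H) (hQ : Q ≤ M.alg) {P : VonNeumannAlgebra M.H}
    (hP : P ≤ Q) : ((M.sub Q hQ).L2Sub P).map (M.inclL2 Q hQ).toLinearMap = M.L2Sub P := by
  refine SetLike.coe_injective ?_
  refine ((M.inclL2 Q hQ).isometry.isClosedEmbedding.closure_image_eq _).symm.trans
    (congrArg closure (Set.ext fun v => ⟨?_, ?_⟩))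
  · rintro ⟨_, ⟨a, ha, rfl⟩, rfl⟩
    exact ⟨M.incl Q hQ a, ha, (M.inclL2_toL2 Q hQ a).symm⟩
  · rintro ⟨a, ha, rfl⟩
    exact ⟨_, ⟨⟨(a : M.H →L[ℂ] M.H), hP ha⟩, ha, rfl⟩, M.inclL2_toL2 Q hQ _⟩

instance (P : VonNeumannAlgebra M.H) : CompleteSpace (M.L2Sub P) :=
  (Submodule.isClosed_topologicalClosure _).completeSpace_coe

lemma norm_condExp_sub (Q : VonNeumannAlgebra M.H) (hQ : Q ≤ M.alg) {P : VonNeumannAlgebra M.H}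
    (hP : P ≤ Q) (v : (M.sub Q hQ).L2) :
    ‖(M.sub Q hQ).condExp P v‖ = ‖M.condExp P (M.inclL2 Q hQ v)‖ := by
  let K : Submodule ℂ (M.sub Q hQ).L2 := (M.sub Q hQ).L2Sub P
  have : CompleteSpace K := (Submodule.isClosed_topologicalClosure _).completeSpace_coe
  have h_map : K.map (M.inclL2 Q hQ).toLinearMap = M.L2Sub P := M.map_inclL2_L2Sub Q hQ hP
  have : CompleteSpace (K.map (M.inclL2 Q hQ).toLinearMap) := by
    rw [h_map]
    infer_instance
  calc ‖K.starProjection v‖ = ‖M.inclL2 Q hQ (K.starProjection v)‖ :=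
        ((M.inclL2 Q hQ).norm_map _).symm
    _ = ‖(K.map (M.inclL2 Q hQ).toLinearMap).starProjection (M.inclL2 Q hQ v)‖ :=
        congrArg norm ((M.inclL2 Q hQ).map_starProjection K v)
    _ = ‖(M.L2Sub P).starProjection (M.inclL2 Q hQ v)‖ := by simp only [h_map]

lemma norm_condExp_le (P : VonNeumannAlgebra M.H) (v : M.L2) : ‖M.condExp P v‖ ≤ ‖v‖ :=
  Submodule.norm_starProjection_apply_le _ _

lemma condExp_of_mem (P : VonNeumannAlgebra M.H) {a : M.Elem} (ha : (a : M.H →L[ℂ] M.H) ∈ P) :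
    M.condExp P (M.toL2 a) = M.toL2 a :=
  M.condExp_toL2_eq P a a ha fun _ _ => rfl

end Subalgebras

end TracialWStarAlgebra

lemma tendsto_of_forall_exists_dist_le {α X : Type*} [PseudoMetricSpace X] {L : Filter α}
    {u : α → X} {b : X}
    (h : ∀ ε : ℝ, 0 < ε → ∃ (v : α → X) (c : X),
      Tendsto v L (𝓝 c) ∧ dist c b ≤ ε ∧ ∀ᶠ a in L, dist (u a) (v a) ≤ ε) :
    Tendsto u L (𝓝 b) := by
  refine Metric.tendsto_nhds.mpr fun ε hε => ?_
  obtain ⟨v, c, hv, hcb, huv⟩ := h (ε / 3) (by positivity)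
  filter_upwards [huv, Metric.tendsto_nhds.mp hv (ε / 3) (by positivity)] with a h₁ h₂
  linarith [dist_triangle4 (u a) (v a) c b]

lemma algHom_freeAlgebra_mem {A X : Type*} [Semiring A] [Algebra ℂ A] (S : Subalgebra ℂ A)
    (φ : FreeAlgebra ℂ X →ₐ[ℂ] A) (h : ∀ i, φ (FreeAlgebra.ι ℂ i) ∈ S) (p : FreeAlgebra ℂ X) :
    φ p ∈ S := by
  induction p using FreeAlgebra.induction with
  | grade0 c => exact φ.commutes c ▸ S.algebraMap_mem c
  | grade1 i => exact h i
  | mul p q hp hq => exact map_mul φ p q ▸ S.mul_mem hp hq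
  | add p q hp hq => exact map_add φ p q ▸ S.add_mem hp hq

namespace NCLaw

variable {I : Type u} {R : I → ℝ}

lemma isInducing_coe : Topology.IsInducing fun l : NCLaw R => (l.1 : NCPoly I → ℂ) := ⟨rfl⟩

lemma continuous_apply (p : NCPoly I) : Continuous fun l : NCLaw R => l.1 p :=
  (_root_.continuous_apply p).comp isInducing_coe.continuous

lemma tendsto_dist_apply {α : Type*} {L : Filter α} {l l' : α → NCLaw R}
    (h : ∀ p, Tendsto (fun a => dist ((l a).1 p) ((l' a).1 p)) L (𝓝 0)) (φ : C(NCLaw R, ℂ)) :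
    Tendsto (fun a => dist (φ (l a)) (φ (l' a))) L (𝓝 0) := by
  let _ : UniformSpace (NCLaw R) := .comap (fun l => (l.1 : NCPoly I → ℂ)) inferInstance
  have hφ : UniformContinuous φ := CompactSpace.uniformContinuous_of_continuous φ.continuous
  have h_unif : Tendsto (fun a => (l a, l' a)) L (uniformity (NCLaw R)) := by
    simp only [uniformity_comap, tendsto_comap_iff, Pi.uniformity, tendsto_iInf]
    exact fun p => tendsto_uniformity_iff_dist_tendsto_zero.mpr (h p)
  exact tendsto_uniformity_iff_dist_tendsto_zero.mp (Tendsto.comp hφ h_unif)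

end NCLaw

namespace TracialWStarAlgebra

/-- A self-adjoint `I`-tuple `x` in `M` with `‖xᵢ‖ ≤ Rᵢ`: a point at which functions of the spaces
`F_{R,2}` and `F_{R,R'}` are evaluated. -/
@[ext]
structure BoundedTuple (M : TracialWStarAlgebra.{u}) {I : Type u} (R : I → ℝ) where
  toFun : I → selfAdjoint M.Elem
  norm_le : ∀ i, ‖(toFun i : M.Elem)‖ ≤ R i

namespace BoundedTuple

variable {M : TracialWStarAlgebra.{u}} {I : Type u} {R : I → ℝ}

instance : CoeFun (M.BoundedTuple R) fun _ => I → selfAdjoint M.Elem := ⟨toFun⟩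

/-- The law `λ_x`, as a point of `Σ_R`. -/
def law (x : M.BoundedTuple R) : NCLaw R := M.law x x.norm_le

end BoundedTuple

end TracialWStarAlgebra

/-- A function that assigns an element `F(x)` of `M` to every self-adjoint tuple `x` with
`‖xᵢ‖ ≤ Rᵢ` in every tracial `W^*`-algebra `M`. -/
abbrev NCFun {I : Type u} (R : I → ℝ) : Type (u + 1) :=
  ∀ M : TracialWStarAlgebra.{u}, M.BoundedTuple R → M.Elem

namespace NCFun

open TracialWStarAlgebra

variable {I : Type u} {R : I → ℝ}

/-- The function `x ↦ p(x)` of a non-commutative polynomial `p`. -/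
def poly : NCPoly I →ₐ[ℂ] NCFun R :=
  AlgHom.pi fun M => AlgHom.pi fun x => M.evalPoly x

/-- The scalar function `x ↦ φ(λ_x) 1`. -/
def ofLaw : C(NCLaw R, ℂ) →ₐ[ℂ] NCFun R :=
  AlgHom.pi fun M => AlgHom.pi fun x =>
    (Algebra.ofId ℂ M.Elem).comp (ContinuousMap.evalAlgHom ℂ ℂ x.law)

/-- The function `x ↦ g(x)` of an element `g` of `A_R = C(Σ_R) ⊗ ℂ⟨tᵢ⟩`. -/
def ofTensor : C(NCLaw R, ℂ) ⊗[ℂ] NCPoly I →ₐ[ℂ] NCFun R :=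
  Algebra.TensorProduct.lift ofLaw poly fun φ p => funext fun M => funext fun x =>
    Algebra.commutes (φ x.law) (M.evalPoly x p)

@[simp] lemma poly_apply (p : NCPoly I) (M : TracialWStarAlgebra.{u}) (x : M.BoundedTuple R) :
    poly p M x = M.evalPoly x p := rfl

lemma ofLaw_apply (φ : C(NCLaw R, ℂ)) (M : TracialWStarAlgebra.{u}) (x : M.BoundedTuple R) :
    ofLaw φ M x = algebraMap ℂ M.Elem (φ x.law) := rfl

@[simp] lemma ofTensor_tmul (φ : C(NCLaw R, ℂ)) (p : NCPoly I) :
    ofTensor (φ ⊗ₜ p) = ofLaw φ * poly p :=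
  rfl

lemma ofTensor_apply (g : C(NCLaw R, ℂ) ⊗[ℂ] NCPoly I) (M : TracialWStarAlgebra.{u})
    (x : M.BoundedTuple R) : ofTensor g M x = M.ev x x.norm_le g := by
  induction g using TensorProduct.induction_on with
  | zero => simp
  | tmul φ p =>
    rw [ev_tmul, ofTensor_tmul, Pi.mul_apply, Pi.mul_apply, ofLaw_apply, poly_apply,
      Algebra.algebraMap_eq_smul_one, smul_one_mul]
    rfl
  | add g h hg hh => rw [map_add, map_add, ← hg, ← hh]; rfl

lemma ofTensor_mem (S : Subalgebra ℂ (NCFun R)) (h_law : ∀ φ, ofLaw φ ∈ S)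
    (h_poly : ∀ p, poly p ∈ S) (g : C(NCLaw R, ℂ) ⊗[ℂ] NCPoly I) : ofTensor g ∈ S := by
  induction g using TensorProduct.induction_on with
  | zero => simp
  | tmul φ p => exact S.mul_mem (h_law φ) (h_poly p)
  | add g h hg hh => exact map_add ofTensor g h ▸ S.add_mem hg hh

lemma norm_ofLaw_le (φ : C(NCLaw R, ℂ)) (M : TracialWStarAlgebra.{u}) (x : M.BoundedTuple R) :
    ‖ofLaw φ M x‖ ≤ ‖φ‖ :=
  (M.norm_algebraMap_le _).trans (φ.norm_coe_le_norm _)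

/-- The algebra of functions that are bounded in operator norm, uniformly over all tuples. -/
def bounded (R : I → ℝ) : Subalgebra ℂ (NCFun R) where
  carrier := {F | ∃ C : ℝ, 0 ≤ C ∧ ∀ M x, ‖F M x‖ ≤ C}
  mul_mem' := by
    rintro F G ⟨C, hC₀, hC⟩ ⟨D, hD₀, hD⟩
    exact ⟨C * D, mul_nonneg hC₀ hD₀, fun M x => (norm_mul_le _ _).trans
      (mul_le_mul (hC M x) (hD M x) (norm_nonneg _) hC₀)⟩
  add_mem' := by
    rintro F G ⟨C, hC₀, hC⟩ ⟨D, hD₀, hD⟩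
    exact ⟨C + D, add_nonneg hC₀ hD₀, fun M x => (norm_add_le _ _).trans
      (add_le_add (hC M x) (hD M x))⟩
  algebraMap_mem' c := ⟨‖c‖, norm_nonneg c, fun M _ => M.norm_algebraMap_le c⟩

lemma ofLaw_mem_bounded (φ : C(NCLaw R, ℂ)) : ofLaw φ ∈ bounded R :=
  ⟨‖φ‖, norm_nonneg φ, norm_ofLaw_le φ⟩

lemma poly_mem_bounded (p : NCPoly I) : poly p ∈ bounded R :=
  algHom_freeAlgebra_mem (bounded R) poly (fun i => ⟨|R i|, abs_nonneg _, fun M x => by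
    simpa using (x.norm_le i).trans (le_abs_self _)⟩) p

lemma ofTensor_mem_bounded (g : C(NCLaw R, ℂ) ⊗[ℂ] NCPoly I) : ofTensor g ∈ bounded R :=
  ofTensor_mem (bounded R) ofLaw_mem_bounded poly_mem_bounded g

end NCFun

namespace NCFun

open TracialWStarAlgebra

variable {I : Type u} {R : I → ℝ}

/-- The distance in `L²(M)` of two functions at a tuple `x` in `M`. -/
def dist2 (F G : NCFun R) (z : Σ M : TracialWStarAlgebra.{u}, M.BoundedTuple R) : ℝ :=
  dist (z.1.toL2 (F z.1 z.2)) (z.1.toL2 (G z.1 z.2))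

lemma dist2_nonneg (F G : NCFun R) (z : Σ M : TracialWStarAlgebra.{u}, M.BoundedTuple R) :
    0 ≤ dist2 F G z :=
  dist_nonneg

lemma dist2_triangle (F G H : NCFun R) (z : Σ M : TracialWStarAlgebra.{u}, M.BoundedTuple R) :
    dist2 F H z ≤ dist2 F G z + dist2 G H z :=
  dist_triangle _ _ _

/-- `F` is the limit, uniformly over all tuples for the `2`-norm, of functions in `A_R`: the
functions with this property are those given by the elements `f` of `F_{R,2}` all of whose values
`f(x)` lie in `M`. -/
def IsApproximable (F : NCFun R) : Prop :=
  ∀ ε : ℝ, 0 < ε → ∃ g, ∀ z, dist2 F (ofTensor g) z ≤ ε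

/-- Pairs of tuples in the same tracial `W^*`-algebra. -/
abbrev TuplePair (R : I → ℝ) : Type (u + 1) :=
  Σ M : TracialWStarAlgebra.{u}, M.BoundedTuple R × M.BoundedTuple R

/-- The filter of pairs `(x, y)` with `‖xᵢ - yᵢ‖₂ → 0` for every `i`. -/
def merging (R : I → ℝ) : Filter (TuplePair R) :=
  comap (fun z i => dist (z.1.toL2 (z.2.1 i)) (z.1.toL2 (z.2.2 i))) (𝓝 0)

/-- The distance `‖F(x) - F(y)‖₂` of the values of `F` at two tuples. -/
def oscillation (F : NCFun R) (z : TuplePair R) : ℝ :=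
  dist (z.1.toL2 (F z.1 z.2.1)) (z.1.toL2 (F z.1 z.2.2))

/-- The algebra of bounded functions `F` that are uniformly continuous for the `2`-norm. -/
def uniformlyContinuous (R : I → ℝ) : Subalgebra ℂ (NCFun R) where
  carrier := {F | F ∈ bounded R ∧ Tendsto (oscillation F) (merging R) (𝓝 0)}
  mul_mem' := by
    rintro F G ⟨⟨C, hC₀, hC⟩, hF⟩ ⟨⟨D, hD₀, hD⟩, hG⟩
    refine ⟨mul_mem ⟨C, hC₀, hC⟩ ⟨D, hD₀, hD⟩, squeeze_zero (fun _ => dist_nonneg)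
      (fun z => (z.1.dist_toL2_mul_le _ _ _ _).trans (add_le_add
        (mul_le_mul_of_nonneg_right (hD _ _) dist_nonneg)
        (mul_le_mul_of_nonneg_right (hC _ _) dist_nonneg))) ?_⟩
    have h_lim := (hF.const_mul D).add (hG.const_mul C)
    rw [mul_zero, mul_zero, add_zero] at h_lim
    exact h_lim
  add_mem' := by
    rintro F G ⟨hF, hF'⟩ ⟨hG, hG'⟩
    refine ⟨add_mem hF hG, squeeze_zero (fun _ => dist_nonneg)
      (fun z => z.1.dist_toL2_add_le _ _ _ _) ?_⟩
    exact (add_zero (0 : ℝ)) ▸ hF'.add hG'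
  algebraMap_mem' c := ⟨algebraMap_mem _ c, by
    have h_zero : oscillation (algebraMap ℂ (NCFun R) c) = 0 := funext fun z => dist_self _
    exact h_zero ▸ tendsto_const_nhds⟩

lemma poly_mem_uniformlyContinuous (p : NCPoly I) : poly p ∈ uniformlyContinuous R := by
  refine algHom_freeAlgebra_mem (uniformlyContinuous R) poly
    (fun i => ⟨poly_mem_bounded _, ?_⟩) p
  have h_osc : oscillation (poly (R := R) (FreeAlgebra.ι ℂ i)) = fun z =>
      dist (z.1.toL2 (z.2.1 i)) (z.1.toL2 (z.2.2 i)) := funext fun z => by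
    simp only [oscillation, poly_apply, evalPoly_ι]
  have h_comap : Tendsto (fun (z : TuplePair R) i => dist (z.1.toL2 (z.2.1 i)) (z.1.toL2 (z.2.2 i)))
      (merging R) (𝓝 0) := tendsto_comap
  exact h_osc ▸ tendsto_pi_nhds.mp h_comap i

lemma tendsto_dist_law_apply (φ : C(NCLaw R, ℂ)) :
    Tendsto (fun z : TuplePair R => dist (φ z.2.1.law) (φ z.2.2.law)) (merging R) (𝓝 0) :=
  NCLaw.tendsto_dist_apply (fun p => squeeze_zero (fun _ => dist_nonneg)
    (fun z => z.1.dist_τ_le _ _) (poly_mem_uniformlyContinuous p).2) φ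

lemma ofLaw_mem_uniformlyContinuous (φ : C(NCLaw R, ℂ)) : ofLaw φ ∈ uniformlyContinuous R := by
  refine ⟨ofLaw_mem_bounded φ, squeeze_zero (fun _ => dist_nonneg) (fun z => ?_)
    (tendsto_dist_law_apply φ)⟩
  refine (z.1.dist_toL2_le _ _).trans ?_
  rw [ofLaw_apply, ofLaw_apply, ← map_sub, dist_eq_norm]
  exact z.1.norm_algebraMap_le _

lemma ofTensor_mem_uniformlyContinuous (g : C(NCLaw R, ℂ) ⊗[ℂ] NCPoly I) :
    ofTensor g ∈ uniformlyContinuous R :=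
  ofTensor_mem _ ofLaw_mem_uniformlyContinuous poly_mem_uniformlyContinuous g

lemma IsApproximable.tendsto_oscillation {F : NCFun R} (hF : F.IsApproximable) :
    Tendsto (oscillation F) (merging R) (𝓝 0) := by
  refine tendsto_of_forall_exists_dist_le fun ε hε => ?_
  obtain ⟨g, hg⟩ := hF (ε / 2) (half_pos hε)
  refine ⟨_, 0, (ofTensor_mem_uniformlyContinuous g).2, (dist_self _).trans_le hε.le,
    .of_forall fun z => (dist_dist_dist_le _ _ _ _).trans ?_⟩
  exact (add_le_add (hg ⟨z.1, z.2.1⟩) (hg ⟨z.1, z.2.2⟩)).trans_eq (add_halves ε)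

lemma exists_finset_of_mem_merging {U : Set (TuplePair R)} (hU : U ∈ merging R) :
    ∃ (S : Finset I) (δ : ℝ), 0 < δ ∧ ∀ z : TuplePair R,
      (∀ i ∈ S, dist (z.1.toL2 (z.2.1 i)) (z.1.toL2 (z.2.2 i)) < δ) → z ∈ U := by
  have h_basis := Filter.HasBasis.pi_self (ι := I) (Metric.nhds_basis_ball (x := (0 : ℝ)))
  rw [merging, nhds_pi] at hU
  obtain ⟨⟨S, δ⟩, ⟨hS, hδ⟩, h_sub⟩ := (h_basis.comap _).mem_iff.mp hU
  refine ⟨hS.toFinset, δ, hδ, fun z hz => h_sub fun i hi => ?_⟩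
  rw [Metric.mem_ball, Real.dist_0_eq_abs, abs_of_nonneg dist_nonneg]
  exact hz i (hS.mem_toFinset.mpr hi)

lemma IsApproximable.of_forall_dist2_le {F : NCFun R}
    (h : ∀ ε : ℝ, 0 < ε → ∃ G : NCFun R, G.IsApproximable ∧ ∀ z, dist2 F G z ≤ ε) :
    F.IsApproximable := by
  intro ε hε
  obtain ⟨G, hG, hFG⟩ := h (ε / 2) (half_pos hε)
  obtain ⟨g, hg⟩ := hG (ε / 2) (half_pos hε)
  exact ⟨g, fun z => by linarith [dist2_triangle F G (ofTensor g) z, hFG z, hg z]⟩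

lemma isApproximable_ofTensor (g : C(NCLaw R, ℂ) ⊗[ℂ] NCPoly I) :
    (ofTensor g : NCFun R).IsApproximable :=
  fun _ hε => ⟨g, fun _ => (dist_self _).trans_le hε.le⟩

lemma IsApproximable.add {F G : NCFun R} (hF : F.IsApproximable) (hG : G.IsApproximable) :
    (F + G).IsApproximable := by
  intro ε hε
  obtain ⟨f, hf⟩ := hF (ε / 2) (half_pos hε)
  obtain ⟨g, hg⟩ := hG (ε / 2) (half_pos hε)
  refine ⟨f + g, fun z => ?_⟩
  rw [map_add]
  exact (z.1.dist_toL2_add_le _ _ _ _).trans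
    ((add_le_add (hf z) (hg z)).trans_eq (add_halves ε))

lemma IsApproximable.mul {F G : NCFun R} (hF : F.IsApproximable) (hG : G.IsApproximable)
    (hG_bdd : G ∈ bounded R) : (F * G).IsApproximable := by
  intro ε hε
  obtain ⟨D, hD₀, hD⟩ := hG_bdd
  obtain ⟨δ, hδ, hDδ⟩ := exists_pos_mul_lt (half_pos hε) D
  obtain ⟨f, hf⟩ := hF δ hδ
  obtain ⟨C, hC₀, hC⟩ := ofTensor_mem_bounded f
  obtain ⟨η, hη, hCη⟩ := exists_pos_mul_lt (half_pos hε) C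
  obtain ⟨g, hg⟩ := hG η hη
  refine ⟨f * g, fun z => ?_⟩
  rw [map_mul]
  calc dist2 (F * G) (ofTensor f * ofTensor g) z
      ≤ ‖G z.1 z.2‖ * dist2 F (ofTensor f) z + ‖ofTensor f z.1 z.2‖ * dist2 G (ofTensor g) z :=
        z.1.dist_toL2_mul_le _ _ _ _
    _ ≤ D * δ + C * η := add_le_add
        (mul_le_mul (hD z.1 z.2) (hf z) (dist2_nonneg _ _ z) hD₀)
        (mul_le_mul (hC z.1 z.2) (hg z) (dist2_nonneg _ _ z) hC₀)
    _ ≤ ε := by linarith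

/-- The algebra of bounded functions that are limits of `A_R`: the space `F_{R,∞}` of the paper,
as an algebra of functions. -/
def lInf (R : I → ℝ) : Subalgebra ℂ (NCFun R) where
  carrier := {F | F ∈ bounded R ∧ F.IsApproximable}
  mul_mem' hF hG := ⟨mul_mem hF.1 hG.1, hF.2.mul hG.2 hG.1⟩
  add_mem' hF hG := ⟨add_mem hF.1 hG.1, hF.2.add hG.2⟩
  algebraMap_mem' c := by
    rw [← (ofTensor (R := R)).commutes c]
    exact ⟨ofTensor_mem_bounded _, isApproximable_ofTensor _⟩

lemma ofTensor_mem_lInf (g : C(NCLaw R, ℂ) ⊗[ℂ] NCPoly I) : ofTensor g ∈ lInf R :=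
  ⟨ofTensor_mem_bounded g, isApproximable_ofTensor g⟩

lemma poly_mem_lInf (p : NCPoly I) : poly p ∈ lInf R := by
  have h := ofTensor_mem_lInf (R := R) (1 ⊗ₜ p)
  rwa [ofTensor_tmul, map_one, one_mul] at h

/-- The filter of tuples whose law tends to `l`. -/
def lawNhds (l : NCLaw R) : Filter (Σ M : TracialWStarAlgebra.{u}, M.BoundedTuple R) :=
  comap (fun z => z.2.law) (𝓝 l)

/-- The polynomial `g(l, ·)` obtained from `g ∈ C(Σ_R) ⊗ ℂ⟨tᵢ⟩` by evaluating the first factor at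
the law `l`. -/
def specialize (l : NCLaw R) : C(NCLaw R, ℂ) ⊗[ℂ] NCPoly I →ₐ[ℂ] NCPoly I :=
  (Algebra.TensorProduct.lid ℂ (NCPoly I)).toAlgHom.comp
    (Algebra.TensorProduct.map (ContinuousMap.evalAlgHom ℂ ℂ l) (AlgHom.id ℂ (NCPoly I)))

@[simp] lemma specialize_tmul (l : NCLaw R) (φ : C(NCLaw R, ℂ)) (p : NCPoly I) :
    specialize l (φ ⊗ₜ p) = φ l • p := rfl

lemma tendsto_dist2_specialize (l : NCLaw R) (g : C(NCLaw R, ℂ) ⊗[ℂ] NCPoly I) :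
    Tendsto (dist2 (ofTensor g) (poly (specialize l g))) (lawNhds l) (𝓝 0) := by
  induction g using TensorProduct.induction_on with
  | zero =>
    refine squeeze_zero (dist2_nonneg _ _) (fun z => ?_) tendsto_const_nhds
    simp [dist2]
  | tmul φ p =>
    obtain ⟨C, -, hC⟩ := poly_mem_bounded (R := R) p
    have hφ : Tendsto (fun z : Σ M : TracialWStarAlgebra.{u}, M.BoundedTuple R =>
        ‖φ z.2.law - φ l‖) (lawNhds l) (𝓝 0) :=
      tendsto_iff_norm_sub_tendsto_zero.mp ((φ.continuous.tendsto l).comp tendsto_comap)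
    refine squeeze_zero (dist2_nonneg _ _) (fun z => ?_) (by simpa using hφ.mul_const C)
    rw [ofTensor_tmul, specialize_tmul, map_smul, dist2, dist_toL2]
    refine (z.1.norm_toL2_le _).trans ?_
    change ‖algebraMap ℂ z.1.Elem (φ z.2.law) * z.1.evalPoly z.2 p - φ l • z.1.evalPoly z.2 p‖ ≤ _
    rw [← Algebra.smul_def, ← sub_smul]
    exact (norm_smul_le _ _).trans (mul_le_mul_of_nonneg_left (hC _ _) (norm_nonneg _))
  | add g h hg hh =>
    refine squeeze_zero (dist2_nonneg _ _) (fun z => ?_) (by simpa using hg.add hh)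
    rw [map_add, map_add, map_add]
    exact z.1.dist_toL2_add_le _ _ _ _

lemma IsApproximable.exists_poly {F : NCFun R} (hF : F.IsApproximable) (l : NCLaw R) {ε : ℝ}
    (hε : 0 < ε) : ∃ p, ∀ᶠ z in lawNhds l, dist2 F (poly p) z ≤ ε := by
  obtain ⟨g, hg⟩ := hF (ε / 2) (half_pos hε)
  refine ⟨specialize l g, ?_⟩
  filter_upwards [(tendsto_dist2_specialize l g).eventually_le_const (half_pos hε)] with z hz
  linarith [dist2_triangle F (ofTensor g) (poly (specialize l g)) z, hg z]

lemma pure_le_lawNhds (M : TracialWStarAlgebra.{u}) (x : M.BoundedTuple R) :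
    pure ⟨M, x⟩ ≤ lawNhds x.law :=
  map_le_iff_le_comap.mp ((map_pure _ _).trans_le (pure_le_nhds _))

lemma IsApproximable.tendsto_τ {F : NCFun R} (hF : F.IsApproximable) (M : TracialWStarAlgebra.{u})
    (x : M.BoundedTuple R) :
    Tendsto (fun z : Σ M : TracialWStarAlgebra.{u}, M.BoundedTuple R => z.1.τ (F z.1 z.2))
      (lawNhds x.law) (𝓝 (M.τ (F M x))) := by
  refine tendsto_of_forall_exists_dist_le fun ε hε => ?_
  obtain ⟨p, hp⟩ := hF.exists_poly x.law hε
  refine ⟨fun z => z.2.law.1 p, x.law.1 p,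
    ((NCLaw.continuous_apply p).tendsto _).comp tendsto_comap, ?_, hp.mono fun z hz => ?_⟩
  · exact (M.dist_τ_le _ _).trans ((dist_comm _ _).trans_le (pure_le_lawNhds M x hp))
  · exact (z.1.dist_τ_le _ _).trans hz

end NCFun

namespace Fun2

open TracialWStarAlgebra

variable {I : Type u} {R : I → ℝ}

lemma continuous_eval (M : TracialWStarAlgebra.{u}) (x : M.BoundedTuple R) :
    Continuous (eval M x x.norm_le) :=
  UniformSpace.Completion.continuous_extension

lemma dist_eval_le (M : TracialWStarAlgebra.{u}) (x : M.BoundedTuple R) (f g : Fun2 R) :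
    dist (eval M x x.norm_le f) (eval M x x.norm_le g) ≤ dist f g := by
  have h_cont := continuous_eval M x
  induction f, g using UniformSpace.Completion.induction_on₂ with
  | hp => exact isClosed_le (by fun_prop) (by fun_prop)
  | ih f g =>
    rw [eval_coe, eval_coe, dist_toL2, ← map_sub, UniformSpace.Completion.dist_eq, dist_eq_norm]
    exact FunA.norm_eval_le M x x.norm_le _

/-- The element of `F_{R,2}` given by `g ∈ A_R`. -/
def ofTensor (g : C(NCLaw R, ℂ) ⊗[ℂ] NCPoly I) : Fun2 R :=
  ((show FunA R from g : FunA R) : UniformSpace.Completion (FunA R))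

lemma eval_ofTensor (g : C(NCLaw R, ℂ) ⊗[ℂ] NCPoly I) (M : TracialWStarAlgebra.{u})
    (x : M.BoundedTuple R) : eval M x x.norm_le (ofTensor g) = M.toL2 (NCFun.ofTensor g M x) :=
  (eval_coe M x x.norm_le _).trans (congrArg M.toL2 (NCFun.ofTensor_apply g M x).symm)

lemma denseRange_ofTensor : DenseRange (ofTensor : _ → Fun2 R) :=
  UniformSpace.Completion.denseRange_coe (α := FunA R)

lemma dist_ofTensor_le (g h : C(NCLaw R, ℂ) ⊗[ℂ] NCPoly I) {C : ℝ} (hC : 0 ≤ C)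
    (hgh : ∀ z, NCFun.dist2 (NCFun.ofTensor g) (NCFun.ofTensor h) z ≤ C) :
    dist (ofTensor g : Fun2 R) (ofTensor h) ≤ C := by
  refine (UniformSpace.Completion.dist_eq _ _).trans_le ?_
  rw [dist_eq_norm]
  refine Real.sSup_le ?_ hC
  rintro _ ⟨M, x, hx, rfl⟩
  have h_val := hgh ⟨M, x, hx⟩
  rw [NCFun.dist2, NCFun.ofTensor_apply, NCFun.ofTensor_apply, dist_toL2, ← map_sub] at h_val
  exact h_val

lemma isApproximable_of_toL2_eq_eval {f : Fun2 R} {F : NCFun R}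
    (hF : ∀ M (x : M.BoundedTuple R), M.toL2 (F M x) = eval M x x.norm_le f) :
    F.IsApproximable := by
  intro ε hε
  obtain ⟨g, hg⟩ := denseRange_ofTensor.exists_dist_lt f hε
  refine ⟨g, fun z => ?_⟩
  rw [NCFun.dist2, hF, ← eval_ofTensor]
  exact (dist_eval_le _ _ _ _).trans hg.le

lemma exists_eval_eq_of_isApproximable {F : NCFun R} (hF : F.IsApproximable) :
    ∃ f : Fun2 R, ∀ M (x : M.BoundedTuple R), eval M x x.norm_le f = M.toL2 (F M x) := by
  choose g hg using fun m : ℕ => hF ((1 / 2) ^ m) (by positivity)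
  have h_cauchy : CauchySeq fun m => (ofTensor (g m) : Fun2 R) := by
    refine cauchySeq_of_le_geometric (1 / 2) 2 (by norm_num) fun m =>
      dist_ofTensor_le _ _ (by positivity) fun z => ?_
    have h_mono : ((1 : ℝ) / 2) ^ (m + 1) ≤ (1 / 2) ^ m :=
      pow_le_pow_of_le_one (by norm_num) (by norm_num) m.le_succ
    refine (dist_triangle_left _ _ (z.1.toL2 (F z.1 z.2))).trans ?_
    exact (add_le_add (hg m z) ((hg (m + 1) z).trans h_mono)).trans_eq (two_mul _).symm
  obtain ⟨f, hf⟩ := cauchySeq_tendsto_of_complete h_cauchy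
  refine ⟨f, fun M (x : M.BoundedTuple R) =>
    tendsto_nhds_unique (((continuous_eval M x).tendsto f).comp hf) ?_⟩
  refine tendsto_iff_dist_tendsto_zero.mpr (squeeze_zero (fun _ => dist_nonneg) (fun m => ?_)
    (tendsto_pow_atTop_nhds_zero_of_lt_one (r := (1 / 2 : ℝ)) (by norm_num) (by norm_num)))
  rw [Function.comp_apply, eval_ofTensor, dist_comm]
  exact hg m ⟨M, x⟩

end Fun2

namespace FunTuple

open TracialWStarAlgebra

variable {I I' : Type u} {R : I → ℝ} {R' : I' → ℝ}

/-- The value `f(x)`, as a tuple with bounds `R'`. -/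
def value (f : FunTuple R R') (M : TracialWStarAlgebra.{u}) (x : M.BoundedTuple R) :
    M.BoundedTuple R' where
  toFun := f.eval M x x.norm_le
  norm_le i := (f.2 i M x x.norm_le).choose_spec.2

/-- The function `x ↦ q(f(x))`. -/
def comp (f : FunTuple R R') : NCPoly I' →ₐ[ℂ] NCFun R :=
  AlgHom.pi fun M => AlgHom.pi fun x => M.evalPoly (f.value M x)

lemma comp_apply (f : FunTuple R R') (q : NCPoly I') (M : TracialWStarAlgebra.{u})
    (x : M.BoundedTuple R) : f.comp q M x = M.evalPoly (f.value M x) q := rfl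

lemma comp_ι (f : FunTuple R R') (i : I') :
    f.comp (FreeAlgebra.ι ℂ i) = fun M x => (f.value M x i : M.Elem) :=
  funext fun M => funext fun _ => M.evalPoly_ι _ i

lemma comp_mem_lInf (f : FunTuple R R') (q : NCPoly I') : f.comp q ∈ NCFun.lInf R := by
  refine algHom_freeAlgebra_mem (NCFun.lInf R) f.comp (fun i => ⟨⟨|R' i|, abs_nonneg _, ?_⟩, ?_⟩) q
  · intro M x
    rw [comp_ι]
    exact ((f.value M x).norm_le i).trans (le_abs_self _)
  · rw [comp_ι]
    exact Fun2.isApproximable_of_toL2_eq_eval fun M x => f.toL2_eval M x x.norm_le i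

end FunTuple

instance (n : ℕ) [NeZero n] : FiniteDimensional ℂ (matrixAlgebra.{u} n).Elem :=
  FiniteDimensional.of_injective (V₂ := CSpace.{u} n →L[ℂ] CSpace.{u} n)
    (allOperators (CSpace.{u} n)).toStarSubalgebra.toSubalgebra.toSubmodule.subtype
    Subtype.val_injective

instance (n : ℕ) [NeZero n] : ProperSpace (matrixAlgebra.{u} n).Elem := FiniteDimensional.proper ℂ _

namespace MatTuple

open NCFun

variable {I I' : Type u} {n : ℕ} [NeZero n] {R : I → ℝ} {R' : I' → ℝ}

lemma continuous_coord (i : I) :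
    Continuous fun A : MatTuple I n => (A i : (matrixAlgebra.{u} n).Elem) :=
  continuous_subtype_val.comp (continuous_apply i)

lemma continuous_evalPoly (p : NCPoly I) :
    Continuous fun A : MatTuple I n => (matrixAlgebra.{u} n).evalPoly A p := by
  induction p using FreeAlgebra.induction with
  | grade0 c => exact continuous_const.congr fun _ => (AlgHom.commutes _ c).symm
  | grade1 i =>
    exact (continuous_coord i).congr fun A => ((matrixAlgebra.{u} n).evalPoly_ι A i).symm
  | mul p q hp hq => exact (hp.mul hq).congr fun _ => (map_mul _ p q).symm
  | add p q hp hq => exact (hp.add hq).congr fun _ => (map_add _ p q).symm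

lemma isClosed_box : IsClosed (box R : Set (MatTuple I n)) := by
  have h_inter : (box R : Set (MatTuple I n)) =
      ⋂ i, {A | ‖(A i : (matrixAlgebra.{u} n).Elem)‖ ≤ R i} := by
    ext
    simp [box]
  rw [h_inter]
  exact isClosed_iInter fun i => isClosed_le (continuous_coord i).norm continuous_const

lemma isOpen_nhd (F : Finset I) (ε : ℝ) (Ω : Set (MatTuple I n)) : IsOpen (nhd F ε Ω) := by
  have h_union : nhd F ε Ω =
      ⋃ A ∈ Ω, ⋂ i ∈ F, {B | (matrixAlgebra.{u} n).norm2 (A i - B i) < ε} := by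
    ext
    simp [nhd]
  rw [h_union]
  refine isOpen_biUnion fun A _ => isOpen_biInter_finset fun i _ => ?_
  simp only [← TracialWStarAlgebra.norm_toL2]
  exact isOpen_lt ((matrixAlgebra.{u} n).toL2CLM.continuous.comp
    (continuous_const.sub (continuous_coord i))).norm continuous_const

/-- A matrix tuple in the box `{A : ‖Aᵢ‖ ≤ Rᵢ}`, as a point at which functions are evaluated. -/
def point (A : (box R : Set (MatTuple I n))) : (matrixAlgebra.{u} n).BoundedTuple R :=
  ⟨A.1, A.2⟩

lemma tendsto_merging (A : (box R : Set (MatTuple I n))) :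
    Tendsto (fun B => (⟨matrixAlgebra n, point B, point A⟩ : TuplePair R)) (𝓝 A) (merging R) := by
  refine tendsto_comap_iff.mpr (tendsto_pi_nhds.mpr fun i => ?_)
  have h_cont := ((matrixAlgebra.{u} n).toL2CLM.continuous.comp (continuous_coord i)).comp
    (continuous_subtype_val (p := (· ∈ (box R : Set (MatTuple I n)))))
  exact tendsto_iff_dist_tendsto_zero.mp (h_cont.tendsto A)

lemma continuous_eval_point {F : NCFun R} (hF : F.IsApproximable) :
    Continuous fun A : (box R : Set (MatTuple I n)) => F (matrixAlgebra n) (point A) := by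
  have h_emb : Topology.IsClosedEmbedding (matrixAlgebra.{u} n).toL2 :=
    LinearMap.isClosedEmbedding_of_injective (𝕜 := ℂ)
      (LinearMap.ker_eq_bot.mpr (matrixAlgebra.{u} n).toL2_injective)
  refine h_emb.isInducing.continuous_iff.mpr (continuous_iff_continuousAt.mpr fun A => ?_)
  have h_osc := hF.tendsto_oscillation.comp (tendsto_merging A)
  exact tendsto_iff_dist_tendsto_zero.mpr h_osc

lemma apply_of_mem_box (f : FunTuple R R') (A : (box R : Set (MatTuple I n))) :
    apply f (A : MatTuple I n) = (f.value (matrixAlgebra n) (point A)).toFun :=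
  dif_pos A.2

lemma continuousOn_apply (f : FunTuple R R') :
    ContinuousOn (apply f : MatTuple I n → MatTuple I' n) (box R) := by
  refine continuousOn_iff_continuous_domRestrict.mpr (continuous_pi
    (A := fun _ => selfAdjoint (matrixAlgebra.{u} n).Elem) fun i => ?_)
  refine continuous_induced_rng.mpr ?_
  refine (continuous_eval_point (f.comp_mem_lInf (FreeAlgebra.ι ℂ i)).2).congr fun A => ?_
  rw [f.comp_ι, Function.comp_apply, Set.domRestrict_apply, apply_of_mem_box]

lemma measurable_apply (f : FunTuple R R') :
    Measurable (apply f : MatTuple I n → MatTuple I' n) := by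
  classical
  let zero : MatTuple I' n := fun _ => 0
  have h_eq : (apply f : MatTuple I n → MatTuple I' n) =
      (box R).piecewise (apply f) fun _ => zero := by
    funext A
    by_cases hA : A ∈ (box R : Set (MatTuple I n))
    · rw [Set.piecewise_eq_of_mem _ _ _ hA]
    · rw [Set.piecewise_eq_of_notMem _ _ _ hA]
      exact dif_neg hA
  rw [h_eq]
  exact (continuousOn_apply f).measurable_piecewise continuousOn_const isClosed_box.measurableSet

lemma apply_mem_box (f : FunTuple R R') {A : MatTuple I n} (hA : A ∈ box R) :
    apply f A ∈ box R' := fun i => by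
  rw [apply_of_mem_box f ⟨A, hA⟩]
  exact (f.value _ _).norm_le i

lemma evalPoly_apply (f : FunTuple R R') (q : NCPoly I') (A : (box R : Set (MatTuple I n))) :
    (matrixAlgebra.{u} n).evalPoly (apply f (A : MatTuple I n)) q =
      f.comp q (matrixAlgebra n) (point A) := by
  rw [apply_of_mem_box, FunTuple.comp_apply]

lemma concentrationFunction_pushforward_le (f : FunTuple R R') (S' : Finset I') {ε : ℝ}
    (hε : 0 < ε) : ∃ (S : Finset I) (δ : ℝ), 0 < δ ∧ ∀ (n : ℕ) [NeZero n]
      (μ : Measure (MatTuple I n)), μ (box R)ᶜ = 0 →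
      concentrationFunction (pushforward f μ) S' ε ≤ concentrationFunction μ S δ := by
  have h_osc : ∀ᶠ z in merging R, ∀ j ∈ S', oscillation (f.comp (FreeAlgebra.ι ℂ j)) z < ε :=
    (Filter.eventually_all_finset S').mpr fun j _ =>
      (f.comp_mem_lInf _).2.tendsto_oscillation.eventually_lt_const hε
  obtain ⟨S, δ, hδ, h_close⟩ := exists_finset_of_mem_merging h_osc
  refine ⟨S, δ, hδ, fun n _ μ hμ => iSup_le fun Ω => iSup_le fun hΩ => iSup_le fun h_half => ?_⟩
  have h_meas := measurable_apply (n := n) f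
  have h_box : ∀ T : Set (MatTuple I n), μ (T ∩ box R) = μ T := fun T => measure_inter_conull hμ
  rw [pushforward, Measure.map_apply h_meas hΩ] at h_half
  rw [pushforward, Measure.map_apply h_meas (isOpen_nhd _ _ _).measurableSet.compl, ← h_box]
  refine le_trans (measure_mono ?_) (le_iSup₂_of_le (apply f ⁻¹' Ω ∩ box R)
    ((h_meas hΩ).inter isClosed_box.measurableSet) (le_iSup_of_le (by rwa [h_box]) le_rfl))
  rintro B ⟨hB, hB_box⟩ ⟨A, ⟨hA, hA_box⟩, hAB⟩
  refine hB ⟨apply f A, hA, fun j hj => ?_⟩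
  have h_j := h_close ⟨matrixAlgebra n, point ⟨A, hA_box⟩, point ⟨B, hB_box⟩⟩ (fun i hi => by
    rw [TracialWStarAlgebra.dist_toL2, TracialWStarAlgebra.norm_toL2]
    exact hAB i hi) j hj
  rw [← TracialWStarAlgebra.norm_toL2, ← TracialWStarAlgebra.dist_toL2,
    apply_of_mem_box f ⟨A, hA_box⟩, apply_of_mem_box f ⟨B, hB_box⟩]
  rwa [f.comp_ι] at h_j

end MatTuple

lemma norm_integral_le_add_of_norm_le_of_notMem {α E : Type*} [MeasurableSpace α]
    [NormedAddCommGroup E] [NormedSpace ℝ E] (μ : Measure α) [IsProbabilityMeasure μ] {D : α → E}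
    {ε C : ℝ} (hε : 0 ≤ ε) (S : Set α) (hD : ∀ᵐ a ∂μ, ‖D a‖ ≤ C)
    (hDS : ∀ᵐ a ∂μ, a ∉ S → ‖D a‖ ≤ ε) :
    ‖∫ a, D a ∂μ‖ ≤ ε + C * μ.real S := by
  let T := toMeasurable μ S
  have hT : MeasurableSet T := measurableSet_toMeasurable μ S
  have h_int : Integrable (T.indicator fun _ => C) μ := (integrable_const C).indicator hT
  refine (norm_integral_le_of_norm_le ((integrable_const ε).add h_int) ?_).trans_eq ?_
  · filter_upwards [hD, hDS] with a ha haS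
    rw [Pi.add_apply]
    by_cases haT : a ∈ T
    · rw [Set.indicator_of_mem haT]
      linarith
    · rw [Set.indicator_of_notMem haT, add_zero]
      exact haS fun h => haT (subset_toMeasurable μ S h)
  · rw [integral_add' (integrable_const ε) h_int, integral_indicator hT, Measure.real,
      ← measure_toMeasurable S]
    simp [T, Measure.real, mul_comm]

namespace MatTuple

open NCFun

variable {I I' : Type u} {R : I → ℝ} {R' : I' → ℝ} {n : ℕ} [NeZero n]

lemma integrable_of_eq_eval {F : NCFun R} (hF : F ∈ lInf R)
    {Φ : MatTuple I n → (matrixAlgebra.{u} n).Elem} (hΦ : ∀ A : (box R : Set (MatTuple I n)),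
      Φ A = F (matrixAlgebra n) (point A))
    (μ : Measure (MatTuple I n)) [IsFiniteMeasure μ] (hμ : μ (box R)ᶜ = 0) : Integrable Φ μ := by
  obtain ⟨C, -, hC⟩ := hF.1
  have h_box : ∀ᵐ A ∂μ, A ∈ box R := hμ
  refine .of_bound ?_ C (h_box.mono fun A hA => ?_)
  · rw [← Measure.restrict_eq_self_of_ae_mem h_box]
    refine ContinuousOn.aestronglyMeasurable ?_ isClosed_box.measurableSet
    exact continuousOn_iff_continuous_domRestrict.mpr
      ((continuous_eval_point hF.2).congr fun A => (hΦ A).symm)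
  · rw [hΦ ⟨A, hA⟩]
    exact hC _ _

lemma isClosed_le_norm_τ_evalPoly_sub (p : NCPoly I) (c : ℂ) (ε : ℝ) :
    IsClosed {A : MatTuple I n | ε ≤ ‖(matrixAlgebra.{u} n).τ
      ((matrixAlgebra.{u} n).evalPoly A p) - c‖} :=
  isClosed_le continuous_const (((LinearMap.continuous_of_finiteDimensional
    (matrixAlgebra.{u} n).τ).comp (continuous_evalPoly p)).sub continuous_const).norm

/-- The event that a random matrix tuple lies in the box `{A : ‖Aᵢ‖ ≤ Rᵢ}` and is a point of `S`. -/
def event (S : Set (Σ M : TracialWStarAlgebra.{u}, M.BoundedTuple R)) : Set (MatTuple I n) :=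
  Subtype.val '' {A : (box R : Set (MatTuple I n)) | ⟨matrixAlgebra n, point A⟩ ∈ S}

lemma dist_norm2_integral_le {F G : NCFun R} (hF : F ∈ lInf R) (hG : G ∈ lInf R) {C : ℝ}
    (hC : ∀ M x, ‖(F - G) M x‖ ≤ C) {ε : ℝ} (hε : 0 ≤ ε)
    {Φ Γ : MatTuple I n → (matrixAlgebra.{u} n).Elem}
    (hΦ : ∀ A : (box R : Set (MatTuple I n)), Φ A = F (matrixAlgebra n) (point A))
    (hΓ : ∀ A : (box R : Set (MatTuple I n)), Γ A = G (matrixAlgebra n) (point A))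
    (μ : Measure (MatTuple I n)) [IsProbabilityMeasure μ] (hμ : μ (box R)ᶜ = 0) :
    dist ((matrixAlgebra.{u} n).norm2 (∫ A, Φ A ∂μ)) ((matrixAlgebra.{u} n).norm2 (∫ A, Γ A ∂μ)) ≤
      ε + C * μ.real (event {z | ¬dist2 F G z ≤ ε}) := by
  let N := matrixAlgebra.{u} n
  have h_box : ∀ᵐ A ∂μ, A ∈ box R := hμ
  have hΦ_int := integrable_of_eq_eval hF hΦ μ hμ
  have hΓ_int := integrable_of_eq_eval hG hΓ μ hμ
  calc dist (N.norm2 (∫ A, Φ A ∂μ)) (N.norm2 (∫ A, Γ A ∂μ))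
      ≤ ‖N.toL2CLM (∫ A, Φ A - Γ A ∂μ)‖ := by
        rw [← N.norm_toL2, ← N.norm_toL2, integral_sub hΦ_int hΓ_int, map_sub]
        exact dist_norm_norm_le _ _
    _ = ‖∫ A, N.toL2CLM (Φ A - Γ A) ∂μ‖ :=
        congrArg norm (N.toL2CLM.integral_comp_comm (hΦ_int.sub hΓ_int)).symm
    _ ≤ ε + C * μ.real (event {z | ¬dist2 F G z ≤ ε}) := by
        refine norm_integral_le_add_of_norm_le_of_notMem μ hε _ ?_ ?_
        · filter_upwards [h_box] with A hA
          rw [hΦ ⟨A, hA⟩, hΓ ⟨A, hA⟩]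
          exact (N.norm_toL2_le _).trans (hC N (point ⟨A, hA⟩))
        · filter_upwards [h_box] with A hA hA_event
          rw [hΦ ⟨A, hA⟩, hΓ ⟨A, hA⟩, TracialWStarAlgebra.toL2CLM_apply, ← N.dist_toL2]
          by_contra h_far
          exact hA_event ⟨⟨A, hA⟩, h_far, rfl⟩

/-- The filter of sets `U` of tuples such that a random matrix tuple with distribution `μ^(k)` lies
in `U` with probability tending to `1`: limits along this filter are limits in probability. -/
def inProbability (R : I → ℝ) {n : ℕ → ℕ} [∀ k, NeZero (n k)]
    (μ : ∀ k, Measure (MatTuple I (n k))) :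
    Filter (Σ M : TracialWStarAlgebra.{u}, M.BoundedTuple R) :=
  comk (fun S => Tendsto (fun k => μ k (event S)) atTop (𝓝 0))
    (by simp [event])
    (fun S hS T hTS => tendsto_of_tendsto_of_tendsto_of_le_of_le tendsto_const_nhds hS
      (fun _ => zero_le) fun k => measure_mono (Set.image_mono fun A hA => hTS hA))
    (fun S hS T hT => tendsto_of_tendsto_of_tendsto_of_le_of_le tendsto_const_nhds
      (add_zero (0 : ℝ≥0∞) ▸ hS.add hT) (fun _ => zero_le) fun k =>
        (congrArg (μ k) (Set.image_union _ _ _)).trans_le (measure_union_le _ _))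

lemma eventually_inProbability {n : ℕ → ℕ} [∀ k, NeZero (n k)]
    {μ : ∀ k, Measure (MatTuple I (n k))}
    {p : (Σ M : TracialWStarAlgebra.{u}, M.BoundedTuple R) → Prop} :
    (∀ᶠ z in inProbability R μ, p z) ↔
      Tendsto (fun k => μ k (event {z | ¬p z})) atTop (𝓝 0) :=
  Iff.rfl

end MatTuple

namespace IsRandomMatrixModel

open NCFun MatTuple

variable {I I' : Type u} {M : TracialWStarAlgebra.{u}} {P : VonNeumannAlgebra M.H}
  {R : I → ℝ} {R' : I' → ℝ} {n : ℕ → ℕ} [∀ k, NeZero (n k)]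
  {μ : ∀ k, Measure (MatTuple I (n k))} {x : M.BoundedTuple R}

lemma inProbability_le (h : IsRandomMatrixModel M P x R n μ) :
    inProbability R μ ≤ lawNhds x.law := by
  refine tendsto_iff_comap.mp (NCLaw.isInducing_coe.tendsto_nhds_iff.mpr
    (tendsto_pi_nhds.mpr fun p => Metric.tendsto_nhds.mpr fun ε hε => ?_))
  refine eventually_inProbability.mpr (tendsto_of_tendsto_of_tendsto_of_le_of_le
    tendsto_const_nhds (h.convergence_in_law p ε hε) (fun _ => zero_le) fun k => measure_mono ?_)
  rintro _ ⟨A, hA, rfl⟩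
  exact (not_lt.mp hA).trans_eq (dist_eq_norm _ _)

lemma tendsto_measure_dist_τ (h : IsRandomMatrixModel M P x R n μ) {F : NCFun R}
    (hF : F.IsApproximable) {ε : ℝ} (hε : 0 < ε) :
    Tendsto (fun k => μ k (event {z | ¬dist (z.1.τ (F z.1 z.2)) (M.τ (F M x)) < ε})) atTop (𝓝 0) :=
  eventually_inProbability.mp (Metric.tendsto_nhds.mp ((hF.tendsto_τ M x).mono_left
    h.inProbability_le) ε hε)

lemma tendsto_norm2_integral (h : IsRandomMatrixModel M P x R n μ) {F : NCFun R} (hF : F ∈ lInf R)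
    {Φ : ∀ k, MatTuple I (n k) → (matrixAlgebra.{u} (n k)).Elem}
    (hΦ : ∀ k, ∀ A : (box R : Set (MatTuple I (n k))), Φ k A = F (matrixAlgebra (n k)) (point A)) :
    Tendsto (fun k => (matrixAlgebra.{u} (n k)).norm2 (∫ A, Φ k A ∂μ k)) atTop
      (𝓝 ‖M.condExp P (M.toL2 (F M x))‖) := by
  have h_prob := h.isProbabilityMeasure
  refine tendsto_of_forall_exists_dist_le fun ε hε => ?_
  obtain ⟨p, hp⟩ := hF.2.exists_poly x.law (half_pos hε)
  obtain ⟨C, -, hC⟩ := sub_mem hF.1 (poly_mem_bounded p)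
  refine ⟨_, _, h.external_averaging p, ?_, ?_⟩
  · refine (dist_norm_norm_le _ _).trans ?_
    rw [← map_sub, ← map_sub]
    refine (M.norm_condExp_le P _).trans ?_
    rw [← M.dist_toL2, dist_comm]
    exact (pure_le_lawNhds M x hp).trans (half_le_self hε.le)
  · have h_real := (ENNReal.tendsto_toReal ENNReal.zero_ne_top).comp
      (eventually_inProbability.mp (h.inProbability_le hp))
    have h_bad := h_real.const_mul C
    rw [ENNReal.toReal_zero, mul_zero] at h_bad
    filter_upwards [h_bad.eventually_le_const (half_pos hε)] with k hk
    exact (dist_norm2_integral_le hF (poly_mem_lInf p) hC (half_pos hε).le (hΦ k) (fun _ => rfl)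
      (μ k) (h.operator_norm_bound k)).trans ((add_le_add_right hk _).trans_eq (add_halves ε))

theorem pushforward (h : IsRandomMatrixModel M P x R n μ) {N : TracialWStarAlgebra.{u}}
    {Q : VonNeumannAlgebra N.H} {y : I' → selfAdjoint N.Elem} (f : FunTuple R R')
    (hτ : ∀ q, N.τ (N.evalPoly y q) = M.τ (f.comp q M x))
    (hE : ∀ q, ‖N.condExp Q (N.toL2 (N.evalPoly y q))‖ = ‖M.condExp P (M.toL2 (f.comp q M x))‖) :
    IsRandomMatrixModel N Q y R' n fun k => MatTuple.pushforward f (μ k) where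
  isProbabilityMeasure k :=
    have := h.isProbabilityMeasure k
    Measure.isProbabilityMeasure_map (measurable_apply f).aemeasurable
  operator_norm_bound k := by
    rw [MatTuple.pushforward,
      Measure.map_apply (measurable_apply f) isClosed_box.measurableSet.compl]
    exact measure_mono_null (fun A hA hA' => hA (apply_mem_box f hA')) (h.operator_norm_bound k)
  convergence_in_law q ε hε := by
    refine tendsto_of_tendsto_of_tendsto_of_le_of_le tendsto_const_nhds
      (h.tendsto_measure_dist_τ (f.comp_mem_lInf q).2 hε) (fun _ => zero_le) fun k => ?_
    rw [MatTuple.pushforward, Measure.map_apply (measurable_apply f)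
      (isClosed_le_norm_τ_evalPoly_sub q _ ε).measurableSet, hτ,
      ← measure_inter_conull (h.operator_norm_bound k)]
    refine measure_mono ?_
    rintro A ⟨hA, hA_box⟩
    refine ⟨⟨A, hA_box⟩, not_lt.mpr ?_, rfl⟩
    change _ ≤ dist ((matrixAlgebra (n k)).τ (f.comp q (matrixAlgebra (n k)) (point ⟨A, hA_box⟩))) _
    rw [← evalPoly_apply, dist_eq_norm]
    exact hA
  exponential_concentration S' ε hε := by
    obtain ⟨S, δ, hδ, h_le⟩ := concentrationFunction_pushforward_le f S' hε
    refine (limsup_le_limsup (.of_forall fun k => ?_)).trans_lt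
      (h.exponential_concentration S δ hδ)
    refine mul_le_mul_of_nonneg_left (ENNReal.log_monotone (h_le (n k) (μ k)
      (h.operator_norm_bound k))) ?_
    exact_mod_cast (by positivity : (0 : ℝ) ≤ 1 / (n k : ℝ) ^ 2)
  external_averaging q := by
    rw [hE]
    refine (h.tendsto_norm2_integral (f.comp_mem_lInf q)
      (Φ := fun k A => (matrixAlgebra (n k)).evalPoly (apply f A) q)
      fun k A => evalPoly_apply f q A).congr fun k => ?_
    rw [MatTuple.pushforward, integral_map (measurable_apply f).aemeasurable
      (continuous_evalPoly (n := n k) q).aestronglyMeasurable]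

end IsRandomMatrixModel

section StrongLimits

variable {𝕜 E F ι : Type*} [NontriviallyNormedField 𝕜] [NormedAddCommGroup E] [NormedSpace 𝕜 E]
  [NormedAddCommGroup F] [NormedSpace 𝕜 F]

/-- The subspace of the vectors `h` such that `T i h` tends to `0` along `L`. -/
def tendstoZeroSubmodule (T : ι → E →L[𝕜] F) (L : Filter ι) : Submodule 𝕜 E where
  carrier := {h | Tendsto (fun i => T i h) L (𝓝 0)}
  zero_mem' := by simpa using tendsto_const_nhds
  add_mem' {g h} hg hh := by
    change Tendsto (fun i => T i (g + h)) L (𝓝 0)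
    simpa only [map_add, add_zero] using Tendsto.add hg hh
  smul_mem' c h hh := by
    change Tendsto (fun i => T i (c • h)) L (𝓝 0)
    simpa only [map_smul, smul_zero] using Tendsto.const_smul hh c

lemma isClosed_tendstoZeroSubmodule {T : ι → E →L[𝕜] F} {r : ℝ} (hT : ∀ i, ‖T i‖ ≤ r)
    (L : Filter ι) : IsClosed (tendstoZeroSubmodule T L : Set E) := by
  refine isClosed_of_closure_subset fun h hh =>
    tendsto_of_forall_exists_dist_le fun ε hε => ?_
  obtain ⟨g, hg, hgh⟩ := Metric.mem_closure_iff.mp hh (ε / (|r| + 1)) (by positivity)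
  refine ⟨fun i => T i g, 0, hg, by simpa using hε.le, .of_forall fun i => ?_⟩
  calc dist (T i h) (T i g) = ‖T i (h - g)‖ := by rw [dist_eq_norm, map_sub]
    _ ≤ (|r| + 1) * ‖h - g‖ :=
      (T i).le_of_opNorm_le ((hT i).trans ((le_abs_self r).trans (by simp))) _
    _ ≤ (|r| + 1) * (ε / (|r| + 1)) := by
      rw [← dist_eq_norm]
      gcongr
    _ = ε := by field_simp

variable [CompleteSpace E] [CompleteSpace F]

lemma exists_tendsto_apply_of_forall_cauchySeq {T : ℕ → E →L[𝕜] F} {r : ℝ} (hT : ∀ k, ‖T k‖ ≤ r)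
    (h_cauchy : ∀ h, CauchySeq fun k => T k h) :
    ∃ S : E →L[𝕜] F, ‖S‖ ≤ r ∧ ∀ h, Tendsto (fun k => T k h) atTop (𝓝 (S h)) := by
  choose S hS using fun h => cauchySeq_tendsto_of_complete (h_cauchy h)
  refine ⟨continuousLinearMapOfTendsto T (tendsto_pi_nhds.mpr hS), ?_, hS⟩
  exact ContinuousLinearMap.opNorm_le_bound _ ((norm_nonneg _).trans (hT 0)) fun h =>
    le_of_tendsto (hS h).norm (.of_forall fun k => (T k).le_of_opNorm_le (hT k) h)

end StrongLimits

section HilbertSpaceLimits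

variable {H : Type u} [NormedAddCommGroup H] [InnerProductSpace ℂ H] [CompleteSpace H]
  {ι : Type*} {L : Filter ι} [L.NeBot] {T : ι → H →L[ℂ] H} {S : H →L[ℂ] H}

lemma isSelfAdjoint_of_tendsto_apply (hT : ∀ i, IsSelfAdjoint (T i))
    (hS : ∀ h, Tendsto (fun i => T i h) L (𝓝 (S h))) : IsSelfAdjoint S := by
  refine ContinuousLinearMap.isSelfAdjoint_iff_isSymmetric.mpr fun g h => ?_
  refine tendsto_nhds_unique ((hS g).inner tendsto_const_nhds)
    ((tendsto_const_nhds.inner (hS h)).congr fun i => ?_)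
  exact (ContinuousLinearMap.isSelfAdjoint_iff_isSymmetric.mp (hT i) g h).symm

lemma mem_vonNeumannAlgebra_of_tendsto_apply {N : VonNeumannAlgebra H} (hT : ∀ i, T i ∈ N)
    (hS : ∀ h, Tendsto (fun i => T i h) L (𝓝 (S h))) : S ∈ N := by
  rw [← N.commutant_commutant, VonNeumannAlgebra.mem_commutant_iff]
  intro t ht
  ext h
  refine tendsto_nhds_unique ((t.continuous.tendsto _).comp (hS h)) ((hS (t h)).congr fun i => ?_)
  exact DFunLike.congr_fun (VonNeumannAlgebra.mem_commutant_iff.mp ht _ (hT i)) h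

end HilbertSpaceLimits

lemma mem_centralizer_centralizer_of_mem_generatedBy {H : Type u} [NormedAddCommGroup H]
    [InnerProductSpace ℂ H] [CompleteSpace H] {S : Set (H →L[ℂ] H)}
    (hS : ∀ T ∈ S, IsSelfAdjoint T) {T : H →L[ℂ] H} (hT : T ∈ VonNeumannAlgebra.generatedBy S) :
    T ∈ Set.centralizer (Set.centralizer S) := by
  have h_star : star S ⊆ S := fun T hT => by
    have h := (hS _ hT).star_eq
    rw [star_star] at h
    rwa [h]
  change T ∈ (StarSubalgebra.centralizer ℂ
    (StarSubalgebra.centralizer ℂ S : Set (H →L[ℂ] H)) : Set (H →L[ℂ] H)) at hT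
  rwa [StarSubalgebra.coe_centralizer_centralizer, Set.union_eq_self_of_subset_right h_star] at hT

namespace TracialWStarAlgebra

variable (M : TracialWStarAlgebra.{u})

lemma exists_dist_evalPoly_lt {I : Type u} (x : I → selfAdjoint M.Elem) {a : M.Elem}
    (ha : (a : M.H →L[ℂ] M.H) ∈ M.wStar x) {ε : ℝ} (hε : 0 < ε) :
    ∃ p : NCPoly I, dist (M.toL2 a) (M.toL2 (M.evalPoly x p)) < ε := by
  obtain ⟨ξ, hξ⟩ := M.exists_norm_toL2_eq_norm_amplify
  let A : M.Elem →ₐ[ℂ] (lp (fun _ : ℕ => M.H) 2 →L[ℂ] lp (fun _ : ℕ => M.H) 2) :=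
    amplify.comp M.alg.subtype.toAlgHom
  let orbit : M.Elem →ₗ[ℂ] lp (fun _ : ℕ => M.H) 2 :=
    { toFun b := A b ξ, map_add' b c := by simp, map_smul' c b := by simp }
  let K := (LinearMap.range (orbit ∘ₗ (M.evalPoly x).toLinearMap)).topologicalClosure
  have : CompleteSpace K := (Submodule.isClosed_topologicalClosure _).completeSpace_coe
  have h_sa : ∀ T ∈ Set.range fun i => ((x i : M.Elem) : M.H →L[ℂ] M.H), IsSelfAdjoint T := by
    rintro _ ⟨i, rfl⟩
    exact congrArg Subtype.val (x i).2
  have h_comm : Commute K.starProjection (A a) := by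
    refine commute_amplify_of_mem_centralizer_centralizer ?_
      (mem_centralizer_centralizer_of_mem_generatedBy h_sa ha)
    rintro _ ⟨i, rfl⟩
    refine commute_starProjection_of_isSelfAdjoint (isSelfAdjoint_amplify (h_sa _ ⟨i, rfl⟩))
      fun v hv => map_mem_closure (A (x i)).continuous hv ?_
    rintro _ ⟨p, rfl⟩
    exact ⟨FreeAlgebra.ι ℂ i * p, by simp [orbit, A]⟩
  have h_one : ξ ∈ K := Submodule.le_topologicalClosure _ ⟨1, by simp [orbit]⟩
  have h_mem : orbit a ∈ K := by
    rw [← Submodule.starProjection_eq_self_iff] at h_one ⊢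
    exact (DFunLike.congr_fun h_comm.eq ξ).trans (congrArg (A a) h_one)
  obtain ⟨_, ⟨p, rfl⟩, hp⟩ := Metric.mem_closure_iff.mp h_mem ε hε
  refine ⟨p, ?_⟩
  rw [dist_toL2, hξ]
  rwa [dist_eq_norm, LinearMap.comp_apply, ← map_sub] at hp

lemma eq_top_of_commutant_invariant {ξ : lp (fun _ : ℕ => M.H) 2}
    (hξ : ∀ a : M.Elem, ‖M.toL2 a‖ = ‖amplify (a : M.H →L[ℂ] M.H) ξ‖) {D : Submodule ℂ M.H}
    (hD : IsClosed (D : Set M.H)) (hξD : ∀ m, ξ m ∈ D)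
    (h_inv : ∀ t ∈ M.alg.commutant, ∀ h ∈ D, t h ∈ D) : D = ⊤ := by
  have : CompleteSpace D := hD.completeSpace_coe
  have h_mem : D.starProjection ∈ M.alg := by
    rw [VonNeumannAlgebra.IsStarProjection.mem_iff isStarProjection_starProjection]
    intro t ht
    rw [Submodule.range_starProjection, Module.End.mem_invtSubmodule]
    exact h_inv t ht
  let e : M.Elem := ⟨D.starProjection, h_mem⟩
  have h_fix : amplify ((e - 1 : M.Elem) : M.H →L[ℂ] M.H) ξ = 0 := by
    ext m
    change D.starProjection (ξ m) - ξ m = 0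
    rw [Submodule.starProjection_eq_self_iff.mpr (hξD m), sub_self]
  have h_one : e = 1 := by
    rw [← sub_eq_zero, ← map_eq_zero_iff _ M.toL2_injective, ← norm_eq_zero, hξ, h_fix, norm_zero]
  refine eq_top_iff.mpr fun h _ => Submodule.starProjection_eq_self_iff.mp ?_
  exact DFunLike.congr_fun (congrArg Subtype.val h_one) h

lemma tendsto_toL2_zero_iff {ι : Type*} {L : Filter ι} {b : ι → M.Elem} {r : ℝ}
    (hb : ∀ i, ‖b i‖ ≤ r) :
    Tendsto (fun i => M.toL2 (b i)) L (𝓝 0) ↔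
      ∀ h, Tendsto (fun i => (b i : M.H →L[ℂ] M.H) h) L (𝓝 0) := by
  obtain ⟨ξ, hξ⟩ := M.exists_norm_toL2_eq_norm_amplify
  let D := tendstoZeroSubmodule (fun i => (b i : M.H →L[ℂ] M.H)) L
  let D' := tendstoZeroSubmodule
    (fun i => (amplify (b i : M.H →L[ℂ] M.H) : lp (fun _ : ℕ => M.H) 2 →L[ℂ] _)) L
  have h_iff : Tendsto (fun i => M.toL2 (b i)) L (𝓝 0) ↔ ξ ∈ D' := by
    rw [tendsto_zero_iff_norm_tendsto_zero]
    simp only [hξ]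
    exact tendsto_zero_iff_norm_tendsto_zero.symm
  rw [h_iff]
  constructor
  · intro h_mem h
    have h_top : D = ⊤ := by
      refine M.eq_top_of_commutant_invariant hξ (isClosed_tendstoZeroSubmodule hb L) (fun m => ?_)
        fun t ht h hh => ?_
      · exact squeeze_zero_norm (fun i =>
          lp.norm_apply_le_norm two_ne_zero (amplify (b i : M.H →L[ℂ] M.H) ξ) m)
          (tendsto_zero_iff_norm_tendsto_zero.mp h_mem)
      · refine Tendsto.congr (fun i => ?_) ((t.continuous.tendsto' 0 0 (map_zero t)).comp hh)
        exact (DFunLike.congr_fun (VonNeumannAlgebra.mem_commutant_iff.mp ht _ (b i).2) h).symm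
    exact Submodule.eq_top_iff'.mp h_top h
  · intro h_apply
    have h_bdd (i) := (norm_amplify_le (ι := ℕ) (b i : M.H →L[ℂ] M.H)).trans (hb i)
    refine (isClosed_tendstoZeroSubmodule h_bdd L).mem_of_tendsto
      (lp.hasSum_single (by simp) ξ) (.of_forall fun s => Submodule.sum_mem _ fun m _ => ?_)
    change Tendsto (fun i => amplify (b i : M.H →L[ℂ] M.H) (lp.single 2 m (ξ m))) L (𝓝 0)
    simp only [amplify_single]
    refine tendsto_zero_iff_norm_tendsto_zero.mpr ?_
    simpa only [lp.norm_single two_pos, norm_zero] using (h_apply (ξ m)).norm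

lemma tendsto_toL2_iff {ι : Type*} {L : Filter ι} {a : ι → M.Elem} {b : M.Elem} {r : ℝ}
    (ha : ∀ i, ‖a i‖ ≤ r) :
    Tendsto (fun i => M.toL2 (a i)) L (𝓝 (M.toL2 b)) ↔
      ∀ h, Tendsto (fun i => (a i : M.H →L[ℂ] M.H) h) L (𝓝 ((b : M.H →L[ℂ] M.H) h)) := by
  have h_iff := M.tendsto_toL2_zero_iff (L := L) (b := fun i => a i - b) (r := r + ‖b‖)
    fun i => (norm_sub_le _ _).trans (add_le_add_left (ha i) _)
  rw [← tendsto_sub_nhds_zero_iff]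
  simp only [map_sub] at h_iff
  rw [h_iff]
  exact forall_congr' fun h => tendsto_sub_nhds_zero_iff

lemma cauchySeq_apply {a : ℕ → M.Elem} {r : ℝ} (hr : ∀ k, ‖a k‖ ≤ r)
    (h_cauchy : CauchySeq fun k => M.toL2 (a k)) (h : M.H) :
    CauchySeq fun k => (a k : M.H →L[ℂ] M.H) h := by
  have h_diff : Tendsto (fun k : ℕ × ℕ => M.toL2 (a k.1 - a k.2)) atTop (𝓝 0) := by
    rw [tendsto_zero_iff_norm_tendsto_zero]
    simpa only [dist_toL2] using cauchySeq_iff_tendsto_dist_atTop_0.mp h_cauchy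
  have h_bound (k : ℕ × ℕ) : ‖a k.1 - a k.2‖ ≤ r + r :=
    (norm_sub_le _ _).trans (add_le_add (hr k.1) (hr k.2))
  rw [cauchySeq_iff_tendsto_dist_atTop_0]
  simp only [dist_eq_norm]
  exact tendsto_zero_iff_norm_tendsto_zero.mp ((M.tendsto_toL2_zero_iff h_bound).mp h_diff h)

lemma exists_tendsto_toL2 {a : ℕ → M.Elem} (h_sa : ∀ k, IsSelfAdjoint (a k)) {r : ℝ}
    (hr : ∀ k, ‖a k‖ ≤ r) (h_cauchy : CauchySeq fun k => M.toL2 (a k)) :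
    ∃ b : M.Elem, IsSelfAdjoint b ∧ ‖b‖ ≤ r ∧
      Tendsto (fun k => M.toL2 (a k)) atTop (𝓝 (M.toL2 b)) := by
  obtain ⟨b, hb_norm, hb⟩ :=
    exists_tendsto_apply_of_forall_cauchySeq hr (M.cauchySeq_apply hr h_cauchy)
  have hb_mem : b ∈ M.alg := mem_vonNeumannAlgebra_of_tendsto_apply (fun k => (a k).2) hb
  have h_coe (k : ℕ) : IsSelfAdjoint (a k : M.H →L[ℂ] M.H) := congrArg Subtype.val (h_sa k)
  have hb_sa : IsSelfAdjoint b := isSelfAdjoint_of_tendsto_apply h_coe hb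
  have h_lim := (M.tendsto_toL2_iff (b := ⟨b, hb_mem⟩) hr).mpr hb
  exact ⟨⟨b, hb_mem⟩, Subtype.ext hb_sa, hb_norm, h_lim⟩

end TracialWStarAlgebra

/-- The function `t ↦ 2rt / (1 + t²)`, which maps `ℝ` onto `[-r, r]`. -/
def squash (r t : ℝ) : ℝ := r * (2 * t / (1 + t ^ 2))

lemma continuous_squash (r : ℝ) : Continuous (squash r) :=
  continuous_const.mul (.div (by fun_prop) (by fun_prop) fun t => by positivity)

lemma abs_squash_le {r : ℝ} (hr : 0 ≤ r) (t : ℝ) : |squash r t| ≤ r := by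
  rw [squash, abs_mul, abs_of_nonneg hr]
  refine mul_le_of_le_one_right hr ?_
  rw [abs_div, abs_of_pos (show (0 : ℝ) < 1 + t ^ 2 by positivity), div_le_one (by positivity),
    abs_le]
  constructor <;> nlinarith [sq_nonneg (t - 1), sq_nonneg (t + 1)]

/-- A right inverse `s ↦ s / (r + √(r² - s²))` of `squash r` on `[-r, r]`. -/
def unsquash (r s : ℝ) : ℝ := s / (r + √(r ^ 2 - s ^ 2))

lemma continuous_unsquash {r : ℝ} (hr : 0 < r) : Continuous (unsquash r) :=
  .div (by fun_prop) (by fun_prop) fun s => by positivity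

lemma squash_unsquash {r s : ℝ} (hr : 0 < r) (hs : |s| ≤ r) : squash r (unsquash r s) = s := by
  have h_sq := Real.sq_sqrt (sub_nonneg.mpr (sq_le_sq' (abs_le.mp hs).1 (abs_le.mp hs).2))
  have h_ne : r + √(r ^ 2 - s ^ 2) ≠ 0 := by positivity
  rw [squash, unsquash]
  field_simp [h_ne]
  linear_combination -s * h_sq

section CStarAlgebra

variable {A : Type*} [CStarAlgebra A] {a : A}

lemma abs_le_norm_of_mem_spectrum (ha : IsSelfAdjoint a) {t : ℝ} (ht : t ∈ spectrum ℝ a) :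
    |t| ≤ ‖a‖ := by
  simpa only [cfc_id ℝ a, id_eq, Real.norm_eq_abs] using norm_apply_le_norm_cfc id a ht

lemma norm_cfc_squash_le {r : ℝ} (hr : 0 ≤ r) (a : A) : ‖cfc (squash r) a‖ ≤ r :=
  norm_cfc_le hr fun t _ => abs_squash_le hr t

lemma exists_cfc_squash_eq {S : StarSubalgebra ℂ A} (hS : IsClosed (S : Set A)) (haS : a ∈ S)
    (ha : IsSelfAdjoint a) {r : ℝ} (har : ‖a‖ ≤ r) :
    ∃ b ∈ S, IsSelfAdjoint b ∧ cfc (squash r) b = a := by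
  rcases ((norm_nonneg a).trans har).eq_or_lt with rfl | hr
  · exact ⟨0, zero_mem S, .zero A, (norm_le_zero_iff.mp (norm_cfc_squash_le le_rfl 0)).trans
      (norm_le_zero_iff.mp har).symm⟩
  have := hS
  refine ⟨cfc (unsquash r) a, cfc_mem _ haS, cfc_predicate _ _, ?_⟩
  rw [← cfc_comp' _ _ a (continuous_squash r).continuousOn (continuous_unsquash hr).continuousOn]
  calc cfc (fun s => squash r (unsquash r s)) a = cfc id a := cfc_congr fun s hs =>
        squash_unsquash hr ((abs_le_norm_of_mem_spectrum ha hs).trans har)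
    _ = a := cfc_id ℝ a

/-- The element `(1 + a²)⁻¹`, for a self-adjoint `a`. -/
def invOneAddSq (a : A) : A := cfc (fun t : ℝ => (1 + t ^ 2)⁻¹) a

lemma continuous_inv_one_add_sq : Continuous fun t : ℝ => (1 + t ^ 2)⁻¹ :=
  .inv₀ (by fun_prop) fun t => by positivity

lemma norm_invOneAddSq_le (a : A) : ‖invOneAddSq a‖ ≤ 1 := by
  refine norm_cfc_le zero_le_one fun t _ => ?_
  rw [Real.norm_eq_abs, abs_of_nonneg (by positivity)]
  exact inv_le_one_of_one_le₀ (by nlinarith [sq_nonneg t])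

lemma commute_invOneAddSq (ha : IsSelfAdjoint a) : Commute (invOneAddSq a) a := by
  have h := cfc_commute_cfc (R := ℝ) (fun t => (1 + t ^ 2)⁻¹) id a
  rwa [cfc_id ℝ a] at h

lemma invOneAddSq_mul_self (ha : IsSelfAdjoint a) : invOneAddSq a * (1 + a * a) = 1 := by
  have h_cfc : cfc (fun t : ℝ => 1 + t ^ 2) a = 1 + a * a := by
    rw [cfc_const_add (1 : ℝ) _ a (by fun_prop), cfc_pow_id (R := ℝ) a 2, sq, map_one]
  rw [← h_cfc, invOneAddSq, ← cfc_mul _ _ a continuous_inv_one_add_sq.continuousOn (by fun_prop),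
    ← cfc_one ℝ a]
  exact cfc_congr fun t _ => inv_mul_cancel₀ (by positivity)

lemma cfc_squash (ha : IsSelfAdjoint a) (r : ℝ) :
    cfc (squash r) a = (2 * r) • (a * invOneAddSq a) := by
  have h_mul : a * invOneAddSq a = cfc (fun t : ℝ => t * (1 + t ^ 2)⁻¹) a := by
    conv_lhs => enter [1]; rw [← cfc_id' ℝ a]
    exact (cfc_mul _ _ a continuousOn_id continuous_inv_one_add_sq.continuousOn).symm
  rw [h_mul, ← cfc_smul (2 * r) (fun t : ℝ => t * (1 + t ^ 2)⁻¹) a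
    (continuous_id.mul continuous_inv_one_add_sq).continuousOn]
  exact cfc_congr fun t _ => by simp only [squash, smul_eq_mul]; ring

lemma norm_mul_invOneAddSq_le (ha : IsSelfAdjoint a) : ‖a * invOneAddSq a‖ ≤ 1 := by
  have h := norm_cfc_squash_le (show (0 : ℝ) ≤ 2⁻¹ by norm_num) a
  rw [cfc_squash ha, mul_inv_cancel₀ two_ne_zero, one_smul] at h
  exact h.trans (by norm_num)

end CStarAlgebra

lemma mul_sub_mul_eq {A : Type*} [Ring A] {a b x y : A} (hx : x * (1 + a * a) = 1)
    (hxa : Commute x a) (hy : (1 + b * b) * y = 1) :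
    a * x - b * y = x * (a - b) * y - a * x * (a - b) * (b * y) := by
  calc a * x - b * y = x * a * ((1 + b * b) * y) - x * (1 + a * a) * (b * y) := by
        rw [hx, hy, hxa.eq, mul_one, one_mul]
    _ = x * (a - b) * y - x * a * (a - b) * (b * y) := by noncomm_ring
    _ = x * (a - b) * y - a * x * (a - b) * (b * y) := by rw [hxa.eq]

lemma isClosed_coe_vonNeumannAlgebra {H : Type*} [NormedAddCommGroup H] [InnerProductSpace ℂ H]
    [CompleteSpace H] (N : VonNeumannAlgebra H) : IsClosed (N : Set (H →L[ℂ] H)) := by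
  rw [← N.centralizer_centralizer]
  exact Set.isClosed_centralizer _

namespace TracialWStarAlgebra

variable (M : TracialWStarAlgebra.{u})

instance : CStarAlgebra M.Elem :=
  StarSubalgebra.cstarAlgebra (S := StarSubalgebra ℂ (M.H →L[ℂ] M.H)) M.alg.toStarSubalgebra
    (h_closed := isClosed_coe_vonNeumannAlgebra M.alg)

lemma norm_toL2_mul_mul_le {a b : M.Elem} (ha : ‖a‖ ≤ 1) (hb : ‖b‖ ≤ 1) (c : M.Elem) :
    ‖M.toL2 (a * c * b)‖ ≤ ‖M.toL2 c‖ :=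
  (M.norm_toL2_mul_le_right _ _).trans <| (mul_le_of_le_one_right (norm_nonneg _) hb).trans <|
    (M.norm_toL2_mul_le_left _ _).trans (mul_le_of_le_one_left (norm_nonneg _) ha)

lemma dist_toL2_cfc_squash_le {a b : M.Elem} (ha : IsSelfAdjoint a) (hb : IsSelfAdjoint b) {r : ℝ}
    (hr : 0 ≤ r) :
    dist (M.toL2 (cfc (squash r) a)) (M.toL2 (cfc (squash r) b)) ≤
      4 * r * dist (M.toL2 a) (M.toL2 b) := by
  have h_right : (1 + b * b) * invOneAddSq b = 1 := by
    have h_comm := commute_invOneAddSq hb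
    rw [← ((Commute.one_right _).add_right (h_comm.mul_right h_comm)).eq, invOneAddSq_mul_self hb]
  have h_eq := mul_sub_mul_eq (invOneAddSq_mul_self ha) (commute_invOneAddSq ha) h_right
  have h_main : ‖M.toL2 (a * invOneAddSq a - b * invOneAddSq b)‖ ≤ 2 * ‖M.toL2 (a - b)‖ := by
    rw [h_eq, map_sub, two_mul]
    exact (norm_sub_le _ _).trans (add_le_add
      (M.norm_toL2_mul_mul_le (norm_invOneAddSq_le a) (norm_invOneAddSq_le b) _)
      (M.norm_toL2_mul_mul_le (norm_mul_invOneAddSq_le ha) (norm_mul_invOneAddSq_le hb) _))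
  have h_smul (c : M.Elem) : M.toL2 ((2 * r) • c) = (2 * r) • M.toL2 c := by
    rw [← Complex.coe_smul, map_smul, Complex.coe_smul]
  rw [dist_toL2, dist_toL2, cfc_squash ha, cfc_squash hb, ← smul_sub, h_smul,
    norm_smul, Real.norm_of_nonneg (by positivity)]
  calc 2 * r * ‖M.toL2 (a * invOneAddSq a - b * invOneAddSq b)‖
      ≤ 2 * r * (2 * ‖M.toL2 (a - b)‖) := by gcongr
    _ = 4 * r * ‖M.toL2 (a - b)‖ := by ring

end TracialWStarAlgebra

namespace NCLaw

variable {I : Type u} {R : I → ℝ}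

/-- The `2`-norm of the polynomial `q` in the law `λ`, that is `λ(q^* q)^{1/2}`. -/
def norm2 (q : NCPoly I) (l : NCLaw R) : ℝ := √(l.1 (q.adj * q)).re

lemma continuous_norm2 (q : NCPoly I) : Continuous (norm2 q : NCLaw R → ℝ) :=
  Real.continuous_sqrt.comp (Complex.continuous_re.comp (continuous_apply _))

lemma norm2_law (q : NCPoly I) {M : TracialWStarAlgebra.{u}} (x : M.BoundedTuple R) :
    norm2 q x.law = ‖M.toL2 (M.evalPoly x q)‖ := by
  rw [M.norm_toL2, TracialWStarAlgebra.norm2, ← M.evalPoly_adj, ← map_mul]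
  rfl

/-- A continuous cut-off function on `Σ_R`: it is `1` where `q` has `2`-norm at most `δ`, and the
product with `q` has `2`-norm at most `δ` everywhere. -/
def cutoff (q : NCPoly I) {δ : ℝ} (hδ : 0 < δ) : C(NCLaw R, ℂ) where
  toFun l := ((δ / max δ (norm2 q l) : ℝ) : ℂ)
  continuous_toFun := Complex.continuous_ofReal.comp <|
    continuous_const.div (continuous_const.max (continuous_norm2 q)) fun _ =>
      (lt_max_of_lt_left hδ).ne'

end NCLaw

namespace NCFun

open TracialWStarAlgebra

variable {I : Type u} {R : I → ℝ}

lemma isSelfAdjoint_apply {F : NCFun R} (hF : IsSelfAdjoint F) (M : TracialWStarAlgebra.{u})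
    (x : M.BoundedTuple R) : IsSelfAdjoint (F M x) :=
  congrFun (congrFun hF M) x

lemma isApproximable_cfc {f : ℝ → ℝ} (hf : Continuous f) {g : C(NCLaw R, ℂ) ⊗[ℂ] NCPoly I}
    (hg : IsSelfAdjoint (ofTensor g : NCFun R)) :
    IsApproximable fun (M : TracialWStarAlgebra.{u}) (x : M.BoundedTuple R) =>
      cfc f (ofTensor g M x) := by
  intro ε hε
  obtain ⟨C, -, hC⟩ := ofTensor_mem_bounded g
  obtain ⟨q, hq⟩ := exists_polynomial_near_of_continuousOn (-C) C f hf.continuousOn ε hε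
  refine ⟨Polynomial.aeval g (q.map (algebraMap ℝ ℂ)), fun ⟨M, x⟩ => (M.dist_toL2_le _ _).trans ?_⟩
  have hgx := isSelfAdjoint_apply hg M x
  have h_aeval : ofTensor (Polynomial.aeval g (q.map (algebraMap ℝ ℂ))) M x =
      cfc q.eval (ofTensor g M x) := by
    let ev : C(NCLaw R, ℂ) ⊗[ℂ] NCPoly I →ₐ[ℂ] M.Elem :=
      ((Pi.evalAlgHom ℂ _ x).comp (Pi.evalAlgHom ℂ _ M)).comp ofTensor
    calc ev (Polynomial.aeval g (q.map (algebraMap ℝ ℂ))) = Polynomial.aeval (ev g) q := by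
          rw [← Polynomial.aeval_algHom_apply, Polynomial.aeval_map_algebraMap]
      _ = cfc q.eval (ev g) := (cfc_polynomial q _ hgx).symm
  rw [h_aeval, ← cfc_sub _ _ _ hf.continuousOn q.continuous.continuousOn]
  refine norm_cfc_le hε.le fun t ht => ?_
  rw [Real.norm_eq_abs, abs_sub_comm]
  exact (hq t (abs_le.mp ((abs_le_norm_of_mem_spectrum hgx ht).trans (hC M x)))).le

/-- The function `x ↦ φ(λ_x) q(x)` for the cut-off function `φ` of `q` at level `δ`. -/
def truncation (q : NCPoly I) {δ : ℝ} (hδ : 0 < δ) : C(NCLaw R, ℂ) ⊗[ℂ] NCPoly I :=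
  NCLaw.cutoff q hδ ⊗ₜ q

lemma ofTensor_truncation (q : NCPoly I) {δ : ℝ} (hδ : 0 < δ) (M : TracialWStarAlgebra.{u})
    (x : M.BoundedTuple R) :
    ofTensor (truncation q hδ) M x =
      ((δ / max δ ‖M.toL2 (M.evalPoly x q)‖ : ℝ) : ℂ) • M.evalPoly x q := by
  rw [← NCLaw.norm2_law, Algebra.smul_def]
  rfl

lemma isSelfAdjoint_truncation {q : NCPoly I} (hq : IsSelfAdjoint (poly q : NCFun R)) {δ : ℝ}
    (hδ : 0 < δ) : IsSelfAdjoint (ofTensor (truncation q hδ) : NCFun R) :=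
  funext fun M => funext fun x => by
    change star (ofTensor (truncation q hδ) M x) = _
    rw [ofTensor_truncation]
    exact IsSelfAdjoint.smul (Complex.conj_ofReal _) (isSelfAdjoint_apply hq M x)

lemma norm_toL2_truncation_le (q : NCPoly I) {δ : ℝ} (hδ : 0 < δ) (M : TracialWStarAlgebra.{u})
    (x : M.BoundedTuple R) : ‖M.toL2 (ofTensor (truncation q hδ) M x)‖ ≤ δ := by
  rw [ofTensor_truncation, map_smul, norm_smul, Complex.norm_real,
    Real.norm_of_nonneg (by positivity), div_mul_eq_mul_div, div_le_iff₀ (by positivity)]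
  exact mul_le_mul_of_nonneg_left (le_max_right _ _) hδ.le

lemma ofTensor_truncation_of_le {q : NCPoly I} {δ : ℝ} (hδ : 0 < δ) {M : TracialWStarAlgebra.{u}}
    {x : M.BoundedTuple R} (hx : ‖M.toL2 (M.evalPoly x q)‖ ≤ δ) :
    ofTensor (truncation q hδ) M x = M.evalPoly x q := by
  rw [ofTensor_truncation, max_eq_left hx, div_self hδ.ne', Complex.ofReal_one, one_smul]

lemma exists_lift_of_forall_dist_le {M : TracialWStarAlgebra.{u}} (x : M.BoundedTuple R)
    {p : ℕ → NCPoly I} (hp_sa : ∀ k, IsSelfAdjoint (poly (p k) : NCFun R)) {δ : ℕ → ℝ}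
    (hδ : ∀ k, 0 < δ k)
    (hp : ∀ k, dist (M.toL2 (M.evalPoly x (p k))) (M.toL2 (M.evalPoly x (p (k + 1)))) ≤ δ k) :
    ∃ g : ℕ → C(NCLaw R, ℂ) ⊗[ℂ] NCPoly I, (∀ k, IsSelfAdjoint (ofTensor (g k) : NCFun R)) ∧
      (∀ k z, dist2 (ofTensor (g k)) (ofTensor (g (k + 1))) z ≤ δ k) ∧
      ∀ k, ofTensor (g k) M x = M.evalPoly x (p k) := by
  let t (k : ℕ) : C(NCLaw R, ℂ) ⊗[ℂ] NCPoly I := truncation (p (k + 1) - p k) (hδ k)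
  have ht_sa (k : ℕ) : IsSelfAdjoint (ofTensor (t k) : NCFun R) :=
    isSelfAdjoint_truncation (by rw [map_sub]; exact (hp_sa _).sub (hp_sa _)) _
  refine ⟨fun k => 1 ⊗ₜ p 0 + ∑ j ∈ Finset.range k, t j, fun k => ?_, fun k z => ?_, fun k => ?_⟩
  · rw [map_add, map_sum, ofTensor_tmul, map_one, one_mul]
    exact (hp_sa 0).add (isSelfAdjoint_sum _ fun j _ => ht_sa j)
  · beta_reduce
    rw [Finset.sum_range_succ, ← add_assoc, map_add _ _ (t k), dist2, Pi.add_apply, Pi.add_apply,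
      map_add z.1.toL2, dist_self_add_right]
    exact norm_toL2_truncation_le _ _ _ _
  · have ht (j : ℕ) : ofTensor (t j) M x = M.evalPoly x (p (j + 1)) - M.evalPoly x (p j) := by
      rw [← map_sub]
      refine ofTensor_truncation_of_le _ ?_
      rw [map_sub, ← dist_toL2, dist_comm]
      exact hp j
    rw [map_add, map_sum, ofTensor_tmul, map_one, one_mul, Pi.add_apply, Pi.add_apply,
      Finset.sum_apply, Finset.sum_apply, Finset.sum_congr rfl fun j _ => ht j,
      Finset.sum_range_sub (fun j => M.evalPoly x (p j)), poly_apply, add_sub_cancel]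

lemma exists_isApproximable_limit {G : ℕ → NCFun R} (hG_sa : ∀ k, IsSelfAdjoint (G k)) {r C : ℝ}
    (hG_norm : ∀ k M x, ‖G k M x‖ ≤ r) (hG : ∀ k, (G k).IsApproximable)
    (h_step : ∀ k z, dist2 (G k) (G (k + 1)) z ≤ C / 2 / 2 ^ k) :
    ∃ F : NCFun R, IsSelfAdjoint F ∧ (∀ M x, ‖F M x‖ ≤ r) ∧ F.IsApproximable ∧
      ∀ (M : TracialWStarAlgebra.{u}) (x : M.BoundedTuple R),
        Tendsto (fun k => M.toL2 (G k M x)) atTop (𝓝 (M.toL2 (F M x))) := by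
  choose F hF_sa hF_norm hF using
    fun (M : TracialWStarAlgebra.{u}) (x : M.BoundedTuple R) => M.exists_tendsto_toL2
      (fun k => isSelfAdjoint_apply (hG_sa k) M x) (fun k => hG_norm k M x)
      (cauchySeq_of_le_geometric_two fun k => h_step k ⟨M, x⟩)
  refine ⟨F, funext fun M => funext (hF_sa M), hF_norm, .of_forall_dist2_le fun ε hε => ?_, hF⟩
  obtain ⟨k, hk⟩ := ((tendsto_const_nhds.div_atTop
    (tendsto_pow_atTop_atTop_of_one_lt one_lt_two)).eventually_le_const hε).exists
  refine ⟨G k, hG k, fun ⟨M, x⟩ => (dist_comm _ _).trans_le (le_trans ?_ hk)⟩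
  exact dist_le_of_le_geometric_two_of_tendsto (fun k => h_step k ⟨M, x⟩) (hF M x) k

end NCFun

open scoped ComplexStarModule

namespace TracialWStarAlgebra

variable (M : TracialWStarAlgebra.{u}) {I : Type u} {R : I → ℝ}

lemma norm_toL2_realPart_le (a : M.Elem) : ‖M.toL2 (ℜ a : M.Elem)‖ ≤ ‖M.toL2 a‖ := by
  rw [realPart_apply_coe, ← Complex.coe_smul, map_smul, norm_smul, map_add]
  have h := norm_add_le (M.toL2 a) (M.toL2 (star a))
  rw [norm_toL2_star] at h
  norm_num
  linarith

lemma exists_isSelfAdjoint_poly_dist_lt (x : M.BoundedTuple R) {a : M.Elem} (ha : IsSelfAdjoint a)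
    (hax : (a : M.H →L[ℂ] M.H) ∈ M.wStar x) {ε : ℝ} (hε : 0 < ε) :
    ∃ p : NCPoly I, IsSelfAdjoint (NCFun.poly p : NCFun R) ∧
      dist (M.toL2 a) (M.toL2 (M.evalPoly x p)) < ε := by
  obtain ⟨p, hp⟩ := M.exists_dist_evalPoly_lt x hax hε
  have h_real (N : TracialWStarAlgebra.{u}) (y : N.BoundedTuple R) :
      N.evalPoly y ((2⁻¹ : ℂ) • (p + p.adj)) = (ℜ (N.evalPoly y p) : N.Elem) := by
    rw [map_smul, map_add, N.evalPoly_adj, realPart_apply_coe, ← Complex.coe_smul]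
    norm_num
  refine ⟨(2⁻¹ : ℂ) • (p + p.adj), funext fun N => funext fun y => ?_, ?_⟩
  · change star (N.evalPoly y _) = N.evalPoly y _
    rw [h_real]
    exact (ℜ (N.evalPoly y p)).2
  · rw [dist_toL2] at hp ⊢
    rw [h_real, ← ha.coe_realPart, ← AddSubgroupClass.coe_sub, ← map_sub]
    exact (M.norm_toL2_realPart_le _).trans_lt hp

lemma exists_seq_isSelfAdjoint_poly_dist_le (x : M.BoundedTuple R) {a : M.Elem}
    (ha : IsSelfAdjoint a) (hax : (a : M.H →L[ℂ] M.H) ∈ M.wStar x) :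
    ∃ p : ℕ → NCPoly I, (∀ k, IsSelfAdjoint (NCFun.poly (p k) : NCFun R)) ∧
      (∀ k, dist (M.toL2 (M.evalPoly x (p k))) (M.toL2 (M.evalPoly x (p (k + 1)))) ≤
        1 / 2 / 2 ^ k) ∧
      Tendsto (fun k => M.toL2 (M.evalPoly x (p k))) atTop (𝓝 (M.toL2 a)) := by
  choose p hp_sa hp using fun k : ℕ =>
    M.exists_isSelfAdjoint_poly_dist_lt x ha hax (show (0 : ℝ) < 1 / 4 / 2 ^ k by positivity)
  refine ⟨p, hp_sa, fun k => ?_, tendsto_iff_dist_tendsto_zero.mpr ?_⟩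
  · have h_mono : (1 : ℝ) / 4 / 2 ^ (k + 1) ≤ 1 / 4 / 2 ^ k := by gcongr <;> simp
    calc dist _ _ ≤ dist (M.toL2 a) _ + dist (M.toL2 a) _ := dist_triangle_left _ _ _
      _ ≤ 1 / 4 / 2 ^ k + 1 / 4 / 2 ^ k := add_le_add (hp k).le ((hp (k + 1)).le.trans h_mono)
      _ = 1 / 2 / 2 ^ k := by ring
  · exact squeeze_zero (fun _ => dist_nonneg) (fun k => (dist_comm _ _).trans_le (hp k).le)
      (tendsto_const_nhds.div_atTop (tendsto_pow_atTop_atTop_of_one_lt one_lt_two))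

lemma exists_isApproximable_eq (x : M.BoundedTuple R) {a : M.Elem} (ha : IsSelfAdjoint a)
    (hax : (a : M.H →L[ℂ] M.H) ∈ M.wStar x) {r : ℝ} (har : ‖a‖ ≤ r) :
    ∃ F : NCFun R, IsSelfAdjoint F ∧ (∀ N y, ‖F N y‖ ≤ r) ∧ F.IsApproximable ∧ F M x = a := by
  have hr : 0 ≤ r := (norm_nonneg a).trans har
  obtain ⟨b, hbx, hb, rfl⟩ := exists_cfc_squash_eq
    (S := (M.wStar x).toStarSubalgebra.comap M.alg.toStarSubalgebra.subtype)
    ((isClosed_coe_vonNeumannAlgebra (M.wStar x)).preimage continuous_subtype_val) hax ha har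
  obtain ⟨p, hp_sa, hp_step, hp⟩ := M.exists_seq_isSelfAdjoint_poly_dist_le x hb hbx
  obtain ⟨g, hg_sa, hg_step, hgx⟩ :=
    NCFun.exists_lift_of_forall_dist_le x hp_sa (fun k => by positivity) hp_step
  obtain ⟨F, hF_sa, hF_norm, hF, hF_lim⟩ := NCFun.exists_isApproximable_limit (r := r) (C := 4 * r)
    (G := fun k N y => cfc (squash r) (NCFun.ofTensor (g k) N y))
    (fun k => funext fun N => funext fun y => cfc_predicate (p := IsSelfAdjoint) (squash r) _)
    (fun k N y => norm_cfc_squash_le hr _)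
    (fun k => NCFun.isApproximable_cfc (continuous_squash r) (hg_sa k)) fun k ⟨N, y⟩ => by
      refine (N.dist_toL2_cfc_squash_le (NCFun.isSelfAdjoint_apply (hg_sa k) N y)
        (NCFun.isSelfAdjoint_apply (hg_sa (k + 1)) N y) hr).trans ?_
      calc 4 * r * _ ≤ 4 * r * (1 / 2 / 2 ^ k) := by gcongr; exact hg_step k ⟨N, y⟩
        _ = 4 * r / 2 / 2 ^ k := by ring
  refine ⟨F, hF_sa, hF_norm, hF, M.toL2_injective (tendsto_nhds_unique (hF_lim M x) ?_)⟩
  refine tendsto_iff_dist_tendsto_zero.mpr (squeeze_zero (fun _ => dist_nonneg) (fun k =>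
    M.dist_toL2_cfc_squash_le (NCFun.isSelfAdjoint_apply (hg_sa k) M x) hb hr) ?_)
  simp only [hgx]
  simpa using (tendsto_iff_dist_tendsto_zero.mp hp).const_mul (4 * r)

lemma exists_funTuple_value_eq {I' : Type u} {R' : I' → ℝ} (x : M.BoundedTuple R)
    (y : M.BoundedTuple R') (hyx : ∀ i, ((y i : M.Elem) : M.H →L[ℂ] M.H) ∈ M.wStar x) :
    ∃ f : FunTuple R R', f.value M x = y := by
  choose F hF_sa hF_norm hF hFx using fun i =>
    M.exists_isApproximable_eq x (y i).2 (hyx i) (y.norm_le i)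
  choose f hf using fun i => Fun2.exists_eval_eq_of_isApproximable (hF i)
  let f' : FunTuple R R' := ⟨f, fun i N z hz =>
    ⟨⟨F i N ⟨z, hz⟩, NCFun.isSelfAdjoint_apply (hF_sa i) N _⟩, (hf i N ⟨z, hz⟩).symm,
      hF_norm i N _⟩⟩
  refine ⟨f', BoundedTuple.ext (funext fun i => Subtype.ext (M.toL2_injective ?_))⟩
  calc M.toL2 (f'.value M x i) = Fun2.eval M x x.norm_le (f i) := f'.toL2_eval M x x.norm_le i
    _ = M.toL2 (y i) := (hf i M x).trans (by rw [hFx])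

end TracialWStarAlgebra

namespace IsRandomMatrixModel

variable {I I' : Type u} {M : TracialWStarAlgebra.{u}} {P : VonNeumannAlgebra M.H}
  {R : I → ℝ} {R' : I' → ℝ} {n : ℕ → ℕ} [∀ k, NeZero (n k)]

theorem pushforward_generated {μ : ∀ k, Measure (MatTuple I (n k))} {x : M.BoundedTuple R}
    (h : IsRandomMatrixModel M P x R n μ) (f : FunTuple R R')
    (hE : ∀ a : M.Elem, M.condExp P (M.condExp (M.wStar (f.value M x)) (M.toL2 a)) =
      M.condExp (P.inter (M.wStar (f.value M x))) (M.toL2 a)) :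
    IsRandomMatrixModel (M.generated (f.value M x)) (P.inter (M.wStar (f.value M x)))
      (M.generators (f.value M x)) R' n fun k => MatTuple.pushforward f (μ k) := by
  refine h.pushforward f (fun q => ?_) fun q => ?_
  · rw [f.comp_apply, ← M.incl_evalPoly_generators (f.value M x) q]
    rfl
  · let y := f.value M x
    calc _ = ‖M.condExp (P.inter (M.wStar y)) (M.inclL2 (M.wStar y) (M.wStar_le y)
          ((M.generated y).toL2 ((M.generated y).evalPoly (M.generators y) q)))‖ :=
          M.norm_condExp_sub (P := P.inter (M.wStar y)) _ (M.wStar_le y) (fun _ ha => ha.2) _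
      _ = ‖M.condExp (P.inter (M.wStar y)) (M.toL2 (M.evalPoly y q))‖ := by
          rw [← M.incl_evalPoly_generators y q]
          exact congrArg _ (congrArg _ (M.inclL2_toL2 _ _ _))
      _ = ‖M.condExp P (M.condExp (M.wStar y) (M.toL2 (M.evalPoly y q)))‖ := by rw [hE]
      _ = ‖M.condExp P (M.toL2 (M.evalPoly y q))‖ := by
          rw [M.condExp_of_mem _ (M.evalPoly_mem_wStar y q)]

theorem exists_of_wStar_le {x : M.BoundedTuple R} (y : M.BoundedTuple R')
    (hyx : M.wStar y ≤ M.wStar x)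
    (h : ∃ μ : ∀ k, Measure (MatTuple I (n k)), IsRandomMatrixModel M P x R n μ) :
    ∃ ν : ∀ k, Measure (MatTuple I' (n k)), IsRandomMatrixModel M P y R' n ν := by
  obtain ⟨μ, hμ⟩ := h
  obtain ⟨f, rfl⟩ := M.exists_funTuple_value_eq x y fun i => hyx <| by
    simpa only [TracialWStarAlgebra.evalPoly_ι] using M.evalPoly_mem_wStar y (FreeAlgebra.ι ℂ i)
  exact ⟨_, hμ.pushforward f (fun _ => rfl) fun _ => rfl⟩

end IsRandomMatrixModel

end

theorem mainTheorem10_general {I I' : Type u} (M : TracialWStarAlgebra.{u})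
    (P : VonNeumannAlgebra M.H) (x : I → selfAdjoint M.Elem)
    (R : I → ℝ) (hxR : ∀ i, ‖(x i : M.Elem)‖ ≤ R i) (R' : I' → ℝ)
    (n : ℕ → ℕ) [∀ k, NeZero (n k)] :
    (∀ (f : FunTuple R R') (y : I' → selfAdjoint M.Elem), y = f.eval M x hxR →
      (∀ a : M.Elem, M.condExp P (M.condExp (M.wStar y) (M.toL2 a)) =
        M.condExp (P.inter (M.wStar y)) (M.toL2 a)) →
      ∀ μ : ∀ k, Measure (MatTuple I (n k)), IsRandomMatrixModel M P x R n μ →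
        IsRandomMatrixModel (M.generated y) (P.inter (M.wStar y)) (M.generators y) R' n
          (fun k => MatTuple.pushforward f (μ k))) ∧
    (∀ y : I' → selfAdjoint M.Elem, M.wStar y = M.wStar x → (∀ i, ‖(y i : M.Elem)‖ ≤ R' i) →
      ((∃ μ : ∀ k, Measure (MatTuple I (n k)), IsRandomMatrixModel M P x R n μ) ↔
        ∃ ν : ∀ k, Measure (MatTuple I' (n k)), IsRandomMatrixModel M P y R' n ν)) := by
  let x' : M.BoundedTuple R := ⟨x, hxR⟩
  refine ⟨?_, fun y hyx hyR' => ?_⟩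
  · rintro f _ rfl hE μ hμ
    exact IsRandomMatrixModel.pushforward_generated (x := x') hμ f hE
  · let y' : M.BoundedTuple R' := ⟨y, hyR'⟩
    exact ⟨IsRandomMatrixModel.exists_of_wStar_le (x := x') y' hyx.le,
      IsRandomMatrixModel.exists_of_wStar_le (x := y') x' hyx.ge⟩

theorem mainTheorem10 {I I' : Type u} (M : TracialWStarAlgebra.{u})
    (P : VonNeumannAlgebra M.H) (hP : P ≤ M.alg)
    (x : I → selfAdjoint M.Elem) (hx : M.wStar x = M.alg)
    (R : I → ℝ) (hR : ∀ i, 0 < R i) (hxR : ∀ i, ‖(x i : M.Elem)‖ ≤ R i)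
    (R' : I' → ℝ) (hR' : ∀ i, 0 < R' i)
    (n : ℕ → ℕ) [∀ k, NeZero (n k)] (hn : Tendsto n atTop atTop) :
    (∀ (f : FunTuple R R') (y : I' → selfAdjoint M.Elem), y = f.eval M x hxR →
      (∀ a : M.Elem, M.condExp P (M.condExp (M.wStar y) (M.toL2 a)) =
        M.condExp (P.inter (M.wStar y)) (M.toL2 a)) →
      ∀ μ : ∀ k, Measure (MatTuple I (n k)), IsRandomMatrixModel M P x R n μ →
        IsRandomMatrixModel (M.generated y) (P.inter (M.wStar y)) (M.generators y) R' n
          (fun k => MatTuple.pushforward f (μ k))) ∧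
    (∀ y : I' → selfAdjoint M.Elem, M.wStar y = M.alg → (∀ i, ‖(y i : M.Elem)‖ ≤ R' i) →
      ((∃ μ : ∀ k, Measure (MatTuple I (n k)), IsRandomMatrixModel M P x R n μ) ↔
        ∃ ν : ∀ k, Measure (MatTuple I' (n k)), IsRandomMatrixModel M P y R' n ν)) := by
  obtain ⟨h_pushforward, h_generators⟩ := mainTheorem10_general M P x R hxR R' n
  exact ⟨h_pushforward, fun y hy => h_generators y (hy.trans hx.symm)⟩
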